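/- **Setting.** Let $\mathsf{Setup}$ be a (possibly randomized) generator which, for a security parameter $n$, outputs a parameter describing a group $G=\langle g\rangle$ of prime order $q$ with generator $g$ and an encoding of its elements by strings; all algorithms receive $q$, $g$ and the description of the group. An algorithm is PPT if it is a probabilistic (coin-tossing) algorithm that halts, on every input and for all coin tosses, within a number of steps bounded by a fixed polynomial in the length of the input. A function is negligible if its product with every polynomial tends to $0$. The *discrete logarithm assumption* for $\mathsf{Setup}$ says that for every PPT algorithm $\mathcal A$, the probability that $\mathcal A(1^n,q,g,G,g^x)=x$, where the parameter is generated by $\mathsf{Setup}(1^n)$ and $x\leftarrow\mathbb Z_q$ is uniform, is negligible in $n$. The *Schnorr identification scheme* has secret key $s\leftarrow\mathbb Z_q$ and public key $A=g^s$. The prover sends $X=g^x$ with $x\leftarrow\mathbb Z_q$, the verifier replies with a challenge $c\leftarrow\mathbb Z_q$, the prover answers $z=sc+x\in\mathbb Z_q$, and the verifier accepts iff $g^z=A^cX$. Here $\mathbb Z_q$ and $\langle g\rangle$ are $\mathbb Z_q$-modules, with $r\bullet m=m^r$ on $\langle g\rangle$. **Lemma.** Under the discrete logarithm assumption, the Schnorr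 scheme is a secure canonical identification scheme with linearity, that is: 1. (Canonical.) The commitment has superlogarithmic min-entropy: the expectation over the parameter of $\max_{X_0}\Pr[X=X_0]$ is negligible. 2. (Linearity.) For all $t\ge 1$ and $\lambda_1,\dots,\lambda_t\in\mathbb Z_q$: if $(A_i,s_i)$ are key pairs, then $\bigl(\prod_i A_i^{\lambda_i},\sum_i\lambda_is_i\bigr)$ is a key pair; and if $(X_i,c,z_i)$ are honest transcripts for these key pairs with a common challenge $c$, then $\bigl(\prod_iX_i^{\lambda_i},c,\sum_i\lambda_iz_i\bigr)$ is accepted for the public key $\prod_iA_i^{\lambda_i}$. 3. (Correctness.) An honest prover is rejected only with negligible probability. 4. (Security against an aggregated key.) For every PPT adversary $\mathcal A$ the probability that the following experiment outputs $1$ is negligible in $n$. Generate a parameter by $\mathsf{Setup}(1^n)$ and an honest public key $A_1=g^{s}$, $s\leftarrow\mathbb Z_q$. Given $1^n$, the parameter and $A_1$, $\mathcal A$ outputs a state $st_0$ and public keys $A_2,\dots,A_t\in\langle g\rangle$ (with $t\ge 1$ chosen by $\mathcal A$). Choose $\lambda_1,\dots,\lambda_t\leftarrow\mathbb Z_q$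 independently and uniformly. Given $st_0,\lambda_1,\dots,\lambda_t$, $\mathcal A$ outputs a state $st_1$ and a commitment $X\in\langle g\rangle$. Choose $c\leftarrow\mathbb Z_q$ uniformly. Given $st_1$ and $c$, $\mathcal A$ outputs $z\in\mathbb Z_q$. The experiment outputs $1$ iff $g^z=\overline A^{\,c}X$, where $\overline A=\prod_{i=1}^tA_i^{\lambda_i}$ (and outputs $0$ if an output of $\mathcal A$ is not of the required form). -/

import Mathlib

open Filter

noncomputable section

/-! ### Probabilistic polynomial time

Algorithms are programs of a small Turing-complete imperative language over binary trees of natural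
numbers.  Numbers are measured in binary, every elementary operation is charged the full length of
what it reads and writes, and randomness comes from fair coins, each charged one step.  Each operation
can be carried out by a Turing machine in time polynomial in its charge, and a Turing machine can be
simulated with polynomial overhead, so that polynomial time means what it usually does. -/

/-- The data on which algorithms work. -/
inductive Data : Type
  | num : ℕ → Data
  | pair : Data → Data → Data

namespace Data

/-- Length of a datum; numbers are written in binary. -/
def size : Data → ℕ
  | num n => n.size + 1
  | pair a b => a.size + b.size + 1

/-- First component (`0` on a number). -/
def fst : Data → Data
  | num _ => num 0
  | pair a _ => a

/-- Second component (`0` on a number). -/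
def snd : Data → Data
  | num _ => num 0
  | pair _ b => b

/-- The number stored in a leaf (`0` on a pair). -/
def toNat : Data → ℕ
  | num n => n
  | pair _ _ => 0

/-- `1` on a pair, `0` on a number. -/
def isPair : Data → Data
  | num _ => num 0
  | pair _ _ => num 1

/-- Lists are right-nested pairs that end in a number. -/
def ofList : List Data → Data
  | [] => num 0
  | a :: l => pair a (ofList l)

/-- Every datum reads as a list. -/
def toList : Data → List Data
  | num _ => []
  | pair a b => a :: b.toList

/-- The string `1^n`, that is, the number whose binary expansion consists of `n` ones. -/
def unary (n : ℕ) : Data := num (2 ^ n - 1)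

end Data

/-- Binary arithmetic operations; subtraction is truncated, division and remainder are those of `ℕ`. -/
inductive ArithOp : Type
  | add | sub | mul | div | mod

/-- Value of an arithmetic operation. -/
def ArithOp.eval : ArithOp → ℕ → ℕ → ℕ
  | add, a, b => a + b
  | sub, a, b => a - b
  | mul, a, b => a * b
  | div, a, b => a / b
  | mod, a, b => a % b

/-- Programs. A program turns an input into an output. -/
inductive Prog : Type
  /-- return the input -/
  | id : Prog
  /-- return a fixed number -/
  | const : ℕ → Prog
  /-- first component -/
  | fst : Prog
  /-- second component -/
  | snd : Prog
  /-- is the input a pair? -/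
  | isPair : Prog
  /-- arithmetic on an input `(a, b)` -/
  | arith : ArithOp → Prog
  /-- on input `k`, toss `k` fair coins and return them as a number below `2 ^ k` -/
  | coins : Prog
  /-- run the first program, then the second one on its output -/
  | comp : Prog → Prog → Prog
  /-- run both programs on the input, return both outputs -/
  | pair : Prog → Prog → Prog
  /-- on input `(b, y)`, run the first program on `y` if `b` is the number `0`, otherwise the
  second one -/
  | cond : Prog → Prog → Prog
  /-- unbounded loop: run the body; if it returns `(0, y)` stop with output `y`, if it returns
  `(b, y)` for another `b` start over from `y` -/
  | loop : Prog → Prog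

/-- Outcome of a run: an output with the number of steps used, or `none` if the run was cut off. -/
abbrev Outcome : Type := Option (Data × ℕ)

/-- Charge `c` additional steps. -/
def tick (c : ℕ) (m : PMF Outcome) : PMF Outcome :=
  m.map (Option.map fun r => (r.1, c + r.2))

/-- Run `m`, then `k` on its output; step counts add up. -/
def andThen (m : PMF Outcome) (k : Data → PMF Outcome) : PMF Outcome :=
  m.bind fun o => match o with
    | none => PMF.pure none
    | some (y, c) => tick c (k y)

/-- An elementary operation that reads `x` and writes `y`. -/
def elementary (x y : Data) : PMF Outcome :=
  PMF.pure (some (y, x.size + y.size + 1))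

open Classical in
/-- The loop with body `f`, cut off after `k` rounds. -/
def loopRun (f : Data → PMF Outcome) : ℕ → Data → PMF Outcome
  | 0, _ => PMF.pure none
  | k + 1, x => tick (x.size + 1) (andThen (f x) fun y =>
      if y.fst = Data.num 0 then PMF.pure (some (y.snd, 0)) else loopRun f k y.snd)

open Classical in
/-- The distribution of the outcome of a program on an input, when every loop is cut off after `T`
rounds. As each round costs at least one step, a run of at most `T` steps is never cut off. -/
def Prog.run (T : ℕ) : Prog → Data → PMF Outcome
  | .id, x => elementary x x
  | .const n, x => elementary x (.num n)
  | .fst, x => elementary x x.fst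
  | .snd, x => elementary x x.snd
  | .isPair, x => elementary x x.isPair
  | .arith o, x => elementary x (.num (o.eval x.fst.toNat x.snd.toNat))
  | .coins, x => (PMF.uniformOfFintype (Fin (2 ^ x.toNat))).map fun r =>
      some (.num r, x.size + x.toNat + 1)
  | .comp f g, x => andThen (f.run T x) (g.run T)
  | .pair f g, x => tick (x.size + 1) (andThen (f.run T x) fun a =>
      (g.run T x).map (Option.map fun r => (Data.pair a r.1, r.2)))
  | .cond f g, x => tick (x.size + 1) (if x.fst = .num 0 then f.run T x.snd else g.run T x.snd)
  | .loop f, x => loopRun (f.run T) T x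

/-- Probabilistic polynomial-time algorithms: programs that, on every input `x` and for all coin
tosses, halt within `bound (size x)` steps. -/
structure PPT : Type where
  prog : Prog
  bound : Polynomial ℕ
  halts : ∀ x : Data, ∀ o ∈ (prog.run (bound.eval x.size) x).support,
    ∃ y c, o = some (y, c) ∧ c ≤ bound.eval x.size

/-- Distribution of the output on input `x`. -/
def PPT.out (A : PPT) (x : Data) : PMF Data :=
  (A.prog.run (A.bound.eval x.size) x).map fun o => (o.map Prod.fst).getD (.num 0)

/-- Negligible functions of the security parameter: the product with every polynomial tends to `0`. -/
def Negligible (f : ℕ → ℝ) : Prop :=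
  Asymptotics.SuperpolynomialDecay atTop (fun n : ℕ => (n : ℝ)) f

/-! ### Canonical linear identification schemes -/

/-- A three-move identification scheme, with a family of verifiers indexed by a natural number `τ`,
whose secret keys, public keys, commitments and responses form modules over a commutative ring which
contains the finite set `Θ` of challenges. Objects handed to or received from an adversary are
encoded as data. -/
structure IDScheme where
  Param : Type
  setup : ℕ → PMF Param
  /-- the public parameter as a datum -/
  pub : Param → Data
  R : Param → Type
  SK : Param → Type
  PK : Param → Type
  CMT : Param → Type
  RSP : Param → Type
  /-- states of the prover between commitment and response -/
  St : Param → Type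
  [ring : ∀ p, CommRing (R p)]
  [skGroup : ∀ p, AddCommGroup (SK p)]
  [skModule : ∀ p, Module (R p) (SK p)]
  [pkGroup : ∀ p, AddCommGroup (PK p)]
  [pkModule : ∀ p, Module (R p) (PK p)]
  [cmtGroup : ∀ p, AddCommGroup (CMT p)]
  [cmtModule : ∀ p, Module (R p) (CMT p)]
  [rspGroup : ∀ p, AddCommGroup (RSP p)]
  [rspModule : ∀ p, Module (R p) (RSP p)]
  Θ : ∀ p, Finset (R p)
  Θ_nonempty : ∀ p, (Θ p).Nonempty
  keygen : ∀ p, PMF (PK p × SK p)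
  commit : ∀ p, PMF (St p × CMT p)
  respond : ∀ p, St p → SK p → PK p → R p → PMF (RSP p)
  /-- `verify p τ pk cmt ch rsp` -/
  verify : ∀ p, ℕ → PK p → CMT p → R p → RSP p → Bool
  encR : ∀ p, R p → Data
  encPK : ∀ p, PK p → Data
  encCMT : ∀ p, CMT p → Data
  encRSP : ∀ p, RSP p → Data
  encR_injective : ∀ p, Function.Injective (encR p)
  encPK_injective : ∀ p, Function.Injective (encPK p)
  encCMT_injective : ∀ p, Function.Injective (encCMT p)
  encRSP_injective : ∀ p, Function.Injective (encRSP p)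

/-- `k` independent samples. -/
def sampleList {α : Type} (μ : PMF α) : ℕ → PMF (List α)
  | 0 => PMF.pure []
  | k + 1 => μ.bind fun a => (sampleList μ k).bind fun l => PMF.pure (a :: l)

namespace IDScheme

attribute [instance] ring skGroup skModule pkGroup pkModule cmtGroup cmtModule rspGroup rspModule

variable (S : IDScheme)

/-- A uniformly random challenge. -/
def challenge (p : S.Param) : PMF (S.R p) := PMF.uniformOfFinset (S.Θ p) (S.Θ_nonempty p)

/-- The min-entropy of the commitment is superlogarithmic: the probability of guessing it, given the
public parameter, is negligible. -/
def CommitmentEntropy : Prop :=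
  Negligible fun n => (∑' p, S.setup n p * ⨆ X, ((S.commit p).map Prod.snd) X).toReal

/-- Linearity. -/
structure IsLinear : Prop where
  /-- a combination of secret keys is a secret key for the combination of the public keys -/
  keys : ∀ (p : S.Param) (t : ℕ), 1 ≤ t → ∀ (w : Fin t → S.R p) (k : Fin t → S.PK p × S.SK p),
    (∀ i, w i ∈ S.Θ p) → (∀ i, k i ∈ (S.keygen p).support) →
    (∑ i, w i • (k i).1, ∑ i, w i • (k i).2) ∈ (S.keygen p).support
  /-- a combination of honest transcripts with a common challenge is accepted -/
  transcripts : ∀ (p : S.Param) (t : ℕ), 1 ≤ t →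
    ∀ (w : Fin t → S.R p) (k : Fin t → S.PK p × S.SK p) (m : Fin t → S.St p × S.CMT p)
      (c : S.R p) (z : Fin t → S.RSP p),
    (∀ i, w i ∈ S.Θ p) → (∀ i, k i ∈ (S.keygen p).support) →
    (∀ i, m i ∈ (S.commit p).support) → c ∈ S.Θ p →
    (∀ i, z i ∈ (S.respond p (m i).1 (k i).2 (k i).1 c).support) →
    S.verify p t (∑ i, w i • (k i).1) (∑ i, w i • (m i).2) c (∑ i, w i • z i) = true

/-- Result of an honest execution of the protocol with verifier `τ`. -/
def honest (τ n : ℕ) : PMF Bool :=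
  (S.setup n).bind fun p =>
  (S.keygen p).bind fun k =>
  (S.commit p).bind fun m =>
  (S.challenge p).bind fun c =>
  (S.respond p m.1 k.2 k.1 c).bind fun z =>
  PMF.pure (S.verify p τ k.1 m.2 c z)

/-- Correctness: an honest prover is rejected with negligible probability only. -/
def Correct : Prop := ∀ τ : ℕ, 1 ≤ τ → Negligible fun n => (S.honest τ n false).toReal

end IDScheme

/-- The three phases of an impersonator; state is passed on as part of the output. -/
structure Impersonator : Type where
  keys : PPT
  commit : PPT
  respond : PPT

namespace IDScheme

variable (S : IDScheme)

/-- The impersonation experiment against an aggregated key. Given the parameter and `pk₁`, the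
adversary outputs a state and a list `pk₂, …, pk_t` of its choice (so `t ≥ 1` is chosen by it); given
the state and uniform weights `w₁, …, w_t` it outputs a state and a commitment; given the state and a
uniform challenge it outputs a response, which is verified with respect to `∑ wᵢ • pkᵢ`. The
experiment outputs `false` if some output of the adversary does not encode objects of the required
kind. -/
def experiment (A : Impersonator) (n : ℕ) : PMF Bool :=
  (S.setup n).bind fun p =>
  (S.keygen p).bind fun k =>
  (A.keys.out (.pair (.unary n) (.pair (S.pub p) (S.encPK p k.1)))).bind fun y₁ =>
  match y₁.snd.toList.mapM (Function.partialInv (S.encPK p)) with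
  | none => PMF.pure false
  | some pks =>
    (sampleList (S.challenge p) (pks.length + 1)).bind fun w =>
    (A.commit.out (.pair y₁.fst (.ofList (w.map (S.encR p))))).bind fun y₂ =>
    (S.challenge p).bind fun c =>
    (A.respond.out (.pair y₂.fst (S.encR p c))).bind fun y₃ =>
    match Function.partialInv (S.encCMT p) y₂.snd, Function.partialInv (S.encRSP p) y₃ with
    | some X, some z =>
      PMF.pure (S.verify p (pks.length + 1)
        (List.zipWith (fun a b => a • b) w (k.1 :: pks)).sum X c z)
    | _, _ => PMF.pure false

/-- A canonical identification scheme with linearity that satisfies correctness and security. -/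
structure IsSecure : Prop where
  entropy : S.CommitmentEntropy
  linear : S.IsLinear
  correct : S.Correct
  security : ∀ A : Impersonator, Negligible fun n => (S.experiment A n true).toReal

end IDScheme

/-! ### Groups of prime order and the Schnorr scheme -/

/-- A generator of groups of prime order: for each security parameter a distribution on parameters,
each of which describes a group of prime order with a generator and an encoding of its elements. -/
structure GroupGen where
  Param : Type
  setup : ℕ → PMF Param
  G : Param → Type
  [group : ∀ p, CommGroup (G p)]
  prime_card : ∀ p, (Nat.card (G p)).Prime
  gen : ∀ p, G p
  gen_generates : ∀ p (x : G p), x ∈ Subgroup.zpowers (gen p)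
  /-- a description of the group, given to all algorithms -/
  desc : Param → Data
  enc : ∀ p, G p → Data
  enc_injective : ∀ p, Function.Injective (enc p)

namespace GroupGen

attribute [instance] group

variable (𝒢 : GroupGen)

/-- The group order `q`. -/
abbrev order (p : 𝒢.Param) : ℕ := Nat.card (𝒢.G p)

instance orderNeZero (p : 𝒢.Param) : NeZero (𝒢.order p) := ⟨(𝒢.prime_card p).ne_zero⟩

/-- The group, written additively, as a `ℤ/q`-module; `r • x` is the power `x ^ r`. -/
instance groupModule (p : 𝒢.Param) : Module (ZMod (𝒢.order p)) (Additive (𝒢.G p)) :=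
  AddCommGroup.zmodModule fun x => pow_card_eq_one' (x := x.toMul)

/-- The public parameter `(q, g, description of the group)`. -/
def pub (p : 𝒢.Param) : Data :=
  .pair (.num (𝒢.order p)) (.pair (𝒢.enc p (𝒢.gen p)) (𝒢.desc p))

open Classical in
/-- The discrete logarithm experiment: `x` is uniform in `ℤ/q` and the solver, given the parameter
and `g ^ x`, has to output `x`. -/
def dlogExperiment (A : PPT) (n : ℕ) : PMF Bool :=
  (𝒢.setup n).bind fun p =>
  (PMF.uniformOfFintype (ZMod (𝒢.order p))).bind fun x =>
  (A.out (.pair (.unary n) (.pair (𝒢.pub p) (𝒢.enc p (𝒢.gen p ^ x.val))))).bind fun y =>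
  PMF.pure (decide (y = .num x.val))

/-- The discrete logarithm assumption. -/
def DiscreteLogAssumption : Prop :=
  ∀ A : PPT, Negligible fun n => (𝒢.dlogExperiment A n true).toReal

open Classical in
/-- The Schnorr identification scheme: secret key `s`, public key `A = g ^ s`, commitment `X = g ^ x`,
challenge `c`, response `z = s * c + x`, verified by `g ^ z = A ^ c * X`. -/
def schnorr : IDScheme where
  Param := 𝒢.Param
  setup := 𝒢.setup
  pub := 𝒢.pub
  R p := ZMod (𝒢.order p)
  SK p := ZMod (𝒢.order p)
  PK p := Additive (𝒢.G p)
  CMT p := Additive (𝒢.G p)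
  RSP p := ZMod (𝒢.order p)
  St p := ZMod (𝒢.order p)
  Θ _ := Finset.univ
  Θ_nonempty _ := Finset.univ_nonempty
  keygen p := (PMF.uniformOfFintype (ZMod (𝒢.order p))).map fun s =>
    (Additive.ofMul (𝒢.gen p ^ s.val), s)
  commit p := (PMF.uniformOfFintype (ZMod (𝒢.order p))).map fun x =>
    (x, Additive.ofMul (𝒢.gen p ^ x.val))
  respond _ x s _ c := PMF.pure (s * c + x)
  verify p _ A X c z := decide (𝒢.gen p ^ z.val = A.toMul ^ c.val * X.toMul)
  encR _ r := .num r.val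
  encPK p A := 𝒢.enc p A.toMul
  encCMT p X := 𝒢.enc p X.toMul
  encRSP _ z := .num z.val
  encR_injective _ _ _ h := ZMod.val_injective _ (Data.num.inj h)
  encPK_injective p _ _ h := 𝒢.enc_injective p h
  encCMT_injective p _ _ h := 𝒢.enc_injective p h
  encRSP_injective _ _ _ h := ZMod.val_injective _ (Data.num.inj h)

end GroupGen

end

noncomputable section

/-! ### Laws of outcomes -/

/-! Security rests on special soundness, used twice. Two accepted transcripts with one commitment
and distinct challenges give `(z₁ - z₂) • g = (c₁ - c₂) • Ā`, hence the logarithm of the aggregated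
key `Ā`. Write `Ā = w • s • g + B`, where `w` weights the honest key and `B` collects the
adversary's keys. Repeating this with another `w'` and the same remaining weights gives the
logarithm of `w' • s • g + B`. The unknown logarithm of `B` cancels in the difference, and dividing
by `w - w'` gives `s` (`GoodPair.extractKey_eq`). The solver needs only arithmetic modulo `q`, no
group operation.

Since the phases of the adversary are separate programs with explicit state, rewinding means running
a later phase again. Jensen's inequality bounds the square of a success probability by the chance
that two independent reruns both succeed; demanding distinct samples costs `1/q`
(`sq_expect_uniform_le`). One fork over the challenge inside one fork over the honest weight bounds
the fourth power of the adversary's success by twice that of the solver plus `4/q`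
(`pow_four_acceptProb_le`). The discrete logarithm assumption makes the expectation of `1/q`
negligible, because always answering `0` succeeds with probability `1/q`; this also gives the
entropy of the commitment. Linearity and correctness are module identities.

Two matters concern the machine model. Only fair coins are available, so uniform residues are
replaced by reduced random bit strings. Their law is pointwise at least `1 - 2⁻ᵐ` times the uniform
one; with `m` the number of samples drawn, the total loss is a factor of at most `2`
(`solve_uniform_le`). And the solver must be a polynomial-time program: `PolyTime` is closed under
composition, branching, loops with an invariant and folds, which suffices for sampling, modular
powers and the whole reduction (`polyTime_dlogSolver`). -/

theorem PMF.bind_congr_support {α β : Type*} (μ : PMF α) {f g : α → PMF β}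
    (h : ∀ a ∈ μ.support, f a = g a) : μ.bind f = μ.bind g := by
  ext b
  rw [PMF.bind_apply, PMF.bind_apply]
  refine tsum_congr fun a => ?_
  by_cases ha : a ∈ μ.support
  · rw [h a ha]
  · rw [(PMF.apply_eq_zero_iff μ a).2 ha, zero_mul, zero_mul]

theorem PMF.map_congr_support {α β : Type*} (μ : PMF α) {f g : α → β}
    (h : ∀ a ∈ μ.support, f a = g a) : μ.map f = μ.map g :=
  PMF.bind_congr_support μ fun a ha => by simp [h a ha]

/-- Every outcome under `m` is a halting run with at most `B` steps, and its output has law `μ`. -/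
def LawWithin (m : PMF Outcome) (μ : PMF Data) (B : ℕ) : Prop :=
  (∀ o ∈ m.support, ∃ y c, o = some (y, c) ∧ c ≤ B) ∧ m.map (Option.map Prod.fst) = μ.map some

namespace LawWithin

variable {m : PMF Outcome} {μ : PMF Data} {B B' : ℕ}

theorem mono (h : LawWithin m μ B) (hB : B ≤ B') : LawWithin m μ B' :=
  ⟨fun o ho => let ⟨y, c, e, hc⟩ := h.1 o ho; ⟨y, c, e, hc.trans hB⟩, h.2⟩

theorem mem_support (h : LawWithin m μ B) {y : Data} :
    y ∈ μ.support ↔ ∃ c, some (y, c) ∈ m.support := by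
  have h1 : some y ∈ (μ.map some).support ↔ y ∈ μ.support := by
    simp [-PMF.mem_support_iff]
  rw [← h1, ← h.2, PMF.mem_support_map_iff]
  constructor
  · rintro ⟨o, ho, e⟩
    obtain ⟨y', c, rfl, -⟩ := h.1 o ho
    simp only [Option.map_some, Option.some.injEq] at e
    exact ⟨c, e ▸ ho⟩
  · rintro ⟨c, hc⟩
    exact ⟨_, hc, rfl⟩

theorem pure (y : Data) (c : ℕ) : LawWithin (PMF.pure (some (y, c))) (PMF.pure y) c := by
  refine ⟨fun o ho => ⟨y, c, by simpa using ho, le_rfl⟩, ?_⟩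
  simp [PMF.pure_map]

theorem tick (h : LawWithin m μ B) (c : ℕ) : LawWithin (tick c m) μ (c + B) := by
  refine ⟨fun o ho => ?_, ?_⟩
  · obtain ⟨o', ho', rfl⟩ := (PMF.mem_support_map_iff _ _ _).1 ho
    obtain ⟨y, d, rfl, hd⟩ := h.1 o' ho'
    exact ⟨y, c + d, rfl, by lia⟩
  · rw [← h.2, _root_.tick, PMF.map_comp]
    congr 1
    funext o
    cases o <;> rfl

/-- Only outputs that can occur matter for `k`: the time bound of a second program is known only for
inputs of bounded size. -/
theorem andThen {k : Data → PMF Outcome} {κ : Data → PMF Data} (h : LawWithin m μ B)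
    (hk : ∀ y ∈ μ.support, LawWithin (k y) (κ y) B') :
    LawWithin (andThen m k) (μ.bind κ) (B + B') := by
  refine ⟨fun o ho => ?_, ?_⟩
  · obtain ⟨o', ho', h2⟩ := (PMF.mem_support_bind_iff _ _ _).1 ho
    obtain ⟨y, d, rfl, hd⟩ := h.1 o' ho'
    obtain ⟨z, e, rfl, he⟩ := ((hk y (h.mem_support.2 ⟨d, ho'⟩)).tick d).1 o h2
    exact ⟨z, e, rfl, by lia⟩
  -- `K` is the continuation with step counts forgotten; forgetting them turns `andThen` into an
  -- ordinary bind.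
  · let K : Option Data → PMF (Option Data) := fun o =>
      o.elim (PMF.pure none) fun y => (k y).map (Option.map Prod.fst)
    have h1 : (_root_.andThen m k).map (Option.map Prod.fst) =
        (m.map (Option.map Prod.fst)).bind K := by
      rw [_root_.andThen, PMF.map_bind, PMF.bind_map]
      congr 1
      funext o
      rcases o with _ | ⟨y, c⟩
      · simp [K, PMF.pure_map]
      · simp only [_root_.tick, K, PMF.map_comp, Function.comp_apply, Option.map_some,
          Option.elim_some]
        congr 1
        funext o
        cases o <;> rfl
    rw [h1, h.2, PMF.bind_map, PMF.map_bind]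
    exact PMF.bind_congr_support μ fun y hy => (hk y hy).2

theorem map (h : LawWithin m μ B) (g : Data → Data) :
    LawWithin (m.map (Option.map fun r => (g r.1, r.2))) (μ.map g) B := by
  refine ⟨fun o ho => ?_, ?_⟩
  · obtain ⟨o', ho', rfl⟩ := (PMF.mem_support_map_iff _ _ _).1 ho
    obtain ⟨y, d, rfl, hd⟩ := h.1 o' ho'
    exact ⟨g y, d, rfl, hd⟩
  · have : (Option.map Prod.fst ∘ Option.map fun r : Data × ℕ => (g r.1, r.2)) =
        Option.map g ∘ Option.map Prod.fst := by
      funext o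
      cases o <;> rfl
    rw [PMF.map_comp, this, ← PMF.map_comp, h.2, PMF.map_comp, PMF.map_comp]
    rfl

end LawWithin

/-! ### Outputs are no longer than runs, and cut-offs beyond the running time do not matter -/

theorem some_mem_support_tick {c d : ℕ} {y : Data} {m : PMF Outcome}
    (h : some (y, d) ∈ (tick c m).support) : ∃ e, d = c + e ∧ some (y, e) ∈ m.support := by
  obtain ⟨o, ho, e⟩ := (PMF.mem_support_map_iff _ _ _).1 h
  rcases o with _ | ⟨y', c'⟩
  · simp at e
  · simp only [Option.map_some, Option.some.injEq, Prod.mk.injEq] at e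
    exact ⟨c', e.2.symm, e.1 ▸ ho⟩

theorem some_mem_support_andThen {d : ℕ} {y : Data} {m : PMF Outcome} {k : Data → PMF Outcome}
    (h : some (y, d) ∈ (andThen m k).support) :
    ∃ z c e, d = c + e ∧ some (z, c) ∈ m.support ∧ some (y, e) ∈ (k z).support := by
  obtain ⟨o, ho, h2⟩ := (PMF.mem_support_bind_iff _ _ _).1 h
  rcases o with _ | ⟨z, c⟩
  · simp at h2
  · obtain ⟨e, he, h3⟩ := some_mem_support_tick h2
    exact ⟨z, c, e, he, ho, h3⟩

theorem elementary_size {x y z : Data} {c : ℕ} (h : some (z, c) ∈ (elementary x y).support) :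
    z.size ≤ c := by
  rw [elementary, PMF.mem_support_pure_iff] at h
  simp only [Option.some.injEq, Prod.mk.injEq] at h
  obtain ⟨rfl, rfl⟩ := h
  lia

@[simp]
theorem Data.fst_pair (a b : Data) : (pair a b).fst = a := rfl

@[simp]
theorem Data.snd_pair (a b : Data) : (pair a b).snd = b := rfl

@[simp]
theorem Data.toNat_num (n : ℕ) : (num n).toNat = n := rfl

theorem Data.size_fst_le (x : Data) : x.fst.size ≤ x.size := by
  cases x <;> simp only [Data.fst, Data.size, Nat.size_zero] <;> lia

theorem Data.size_snd_le (x : Data) : x.snd.size ≤ x.size := by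
  cases x <;> simp only [Data.snd, Data.size, Nat.size_zero] <;> lia

theorem loopRun_size {f : Data → PMF Outcome}
    (hf : ∀ x y c, some (y, c) ∈ (f x).support → y.size ≤ c) (k : ℕ) :
    ∀ x y c, some (y, c) ∈ (loopRun f k x).support → y.size ≤ c := by
  induction k with
  | zero => intro x y c h; simp [loopRun] at h
  | succ k ih =>
    intro x y c h
    obtain ⟨c', hc, h⟩ := some_mem_support_tick h
    obtain ⟨z, c, e, hd, hz, h⟩ := some_mem_support_andThen h
    split_ifs at h
    · rw [PMF.mem_support_pure_iff] at h
      simp only [Option.some.injEq, Prod.mk.injEq] at h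
      obtain ⟨rfl, rfl⟩ := h
      have := hf _ _ _ hz
      have := z.size_snd_le
      lia
    · have := ih _ _ _ h
      lia

/-- The uniform distribution on the numbers below `2 ^ k`. -/
def uniformBits (k : ℕ) : PMF ℕ :=
  PMF.map (fun i : Fin (2 ^ k) => (i : ℕ)) (PMF.uniformOfFintype _)

theorem Prog.run_coins (T : ℕ) (x : Data) :
    Prog.coins.run T x =
      (uniformBits x.toNat).map fun r => some (.num r, x.size + x.toNat + 1) := rfl

theorem lt_of_mem_support_uniformBits {k r : ℕ} (h : r ∈ (uniformBits k).support) :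
    r < 2 ^ k := by
  obtain ⟨i, -, rfl⟩ := (PMF.mem_support_map_iff _ _ _).1 h
  exact i.isLt

/-- Every operation is charged for what it writes, and `k` coins give a number of at most `k` binary
digits. A time bound is therefore a bound on the input size of the next program. -/
theorem Prog.run_size (P : Prog) (T : ℕ) :
    ∀ x y c, some (y, c) ∈ (P.run T x).support → y.size ≤ c := by
  induction P with
  | id | const _ | fst | snd | isPair | arith _ => exact fun x y c h => elementary_size h
  | coins =>
    intro x y c h
    rw [Prog.run_coins] at h
    obtain ⟨r, hr, e⟩ := (PMF.mem_support_map_iff _ _ _).1 h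
    simp only [Option.some.injEq, Prod.mk.injEq] at e
    obtain ⟨rfl, rfl⟩ := e
    have := Nat.size_le.2 (lt_of_mem_support_uniformBits hr)
    simp only [Data.size]
    have : 1 ≤ x.size := by cases x <;> simp [Data.size]
    lia
  | comp f g hf hg =>
    intro x y c h
    obtain ⟨z, c, e, hd, hz, h⟩ := some_mem_support_andThen h
    have := hg _ _ _ h
    lia
  | pair f g hf hg =>
    intro x y c h
    obtain ⟨c', hc, h⟩ := some_mem_support_tick h
    obtain ⟨z, c, e, hd, hz, h⟩ := some_mem_support_andThen h
    obtain ⟨o, ho, h⟩ := (PMF.mem_support_map_iff _ _ _).1 h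
    rcases o with _ | ⟨w, d⟩
    · simp at h
    · simp only [Option.map_some, Option.some.injEq, Prod.mk.injEq] at h
      obtain ⟨rfl, rfl⟩ := h
      have := hf _ _ _ hz
      have := hg _ _ _ ho
      simp only [Data.size]
      lia
  | cond f g hf hg =>
    intro x y c h
    obtain ⟨c', hc, h⟩ := some_mem_support_tick h
    split_ifs at h
    · have := hf _ _ _ h
      lia
    · have := hg _ _ _ h
      lia
  | loop f hf => exact fun x y c h => loopRun_size hf T x y c h

theorem none_mem_support_tick {c : ℕ} {m : PMF Outcome} :
    none ∈ (tick c m).support ↔ none ∈ m.support := by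
  simp only [tick, PMF.mem_support_map_iff, Option.map_eq_none_iff, exists_eq_right]

/-- If the sequence is never cut off, neither is any part of it that is reached, so agreement is
needed only for such parts. -/
theorem andThen_congr {m m' : PMF Outcome} {k k' : Data → PMF Outcome}
    (hm : none ∉ m.support → m' = m) (hk : ∀ y, none ∉ (k y).support → k' y = k y)
    (h : none ∉ (andThen m k).support) : andThen m' k' = andThen m k := by
  have h1 : none ∉ m.support := fun h1 =>
    h ((PMF.mem_support_bind_iff _ _ _).2 ⟨none, h1, by simp⟩)
  rw [hm h1]
  refine PMF.bind_congr_support m fun o ho => ?_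
  rcases o with _ | ⟨y, c⟩
  · rfl
  · simp only
    rw [hk y fun h2 => h ((PMF.mem_support_bind_iff _ _ _).2
      ⟨_, ho, none_mem_support_tick.2 h2⟩)]

theorem loopRun_mono {f f' : Data → PMF Outcome}
    (hf : ∀ x, none ∉ (f x).support → f' x = f x) {k k' : ℕ} (hk : k ≤ k') (x : Data)
    (h : none ∉ (loopRun f k x).support) : loopRun f' k' x = loopRun f k x := by
  induction k generalizing k' x with
  | zero => simp [loopRun] at h
  | succ k ih =>
    obtain ⟨k', rfl⟩ : ∃ j, k' = j + 1 := ⟨k' - 1, by lia⟩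
    rw [loopRun, none_mem_support_tick] at h
    rw [loopRun, loopRun, andThen_congr (hf x) (fun y hy => ?_) h]
    split_ifs at hy ⊢
    · rfl
    · exact ih (by lia) _ hy

/-- A cut-off that is reached shows up as `none`. If `none` is impossible, raising the cut-off
changes nothing, so a program can run under the larger cut-off of a program containing it. -/
theorem Prog.run_mono (P : Prog) {T T' : ℕ} (hT : T ≤ T') :
    ∀ x, none ∉ (P.run T x).support → P.run T' x = P.run T x := by
  induction P with
  | id | const _ | fst | snd | isPair | arith _ | coins => exact fun x h => rfl
  | comp f g hf hg => exact fun x h => andThen_congr (hf x) hg h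
  | pair f g hf hg =>
    intro x h
    rw [Prog.run, none_mem_support_tick] at h
    rw [Prog.run, Prog.run, andThen_congr (hf x) (fun y hy => ?_) h]
    rw [hg x fun h2 => hy ((PMF.mem_support_map_iff _ _ _).2 ⟨_, h2, rfl⟩)]
  | cond f g hf hg =>
    intro x h
    rw [Prog.run, none_mem_support_tick] at h
    rw [Prog.run, Prog.run]
    split_ifs at h ⊢
    · rw [hf _ h]
    · rw [hg _ h]
  | loop f hf => exact fun x h => loopRun_mono hf hT x h

/-! ### Polynomial-time sampling -/

/-- On input `x` the program halts within `B` steps, and its output has law `μ`. -/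
def Prog.Runs (P : Prog) (x : Data) (μ : PMF Data) (B : ℕ) : Prop :=
  ∀ T, B ≤ T → LawWithin (P.run T x) μ B

theorem Prog.Runs.size_le {P : Prog} {x : Data} {μ : PMF Data} {B : ℕ} (h : P.Runs x μ B)
    {y : Data} (hy : y ∈ μ.support) : y.size ≤ B := by
  obtain ⟨c, hc⟩ := (h B le_rfl).mem_support.1 hy
  obtain ⟨y', c', e, hc'⟩ := (h B le_rfl).1 _ hc
  simp only [Option.some.injEq, Prod.mk.injEq] at e
  exact (P.run_size B x y c hc).trans (e.2 ▸ hc')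

/-- A family of distributions that some program samples in polynomial time. -/
def PolyTime (μ : Data → PMF Data) : Prop :=
  ∃ (P : Prog) (p : Polynomial ℕ), ∀ x, P.Runs x (μ x) (p.eval x.size)

/-- A function that some program computes in polynomial time. -/
@[fun_prop]
def PolyFun (f : Data → Data) : Prop := PolyTime fun x => PMF.pure (f x)

theorem Polynomial.eval_mono_nat (p : Polynomial ℕ) {a b : ℕ} (h : a ≤ b) :
    p.eval a ≤ p.eval b := by
  rw [Polynomial.eval_eq_sum, Polynomial.eval_eq_sum]
  exact Finset.sum_le_sum fun i _ => Nat.mul_le_mul_left _ (Nat.pow_le_pow_left h i)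

theorem PPT.polyTime (A : PPT) : PolyTime A.out := by
  refine ⟨A.prog, A.bound, fun x T hT => ?_⟩
  have h0 : none ∉ (A.prog.run (A.bound.eval x.size) x).support := fun h => by
    obtain ⟨y, c, e, -⟩ := A.halts x _ h
    simp at e
  rw [A.prog.run_mono hT x h0]
  refine ⟨A.halts x, ?_⟩
  rw [PPT.out, PMF.map_comp]
  refine PMF.map_congr_support _ fun o ho => ?_
  obtain ⟨y, c, rfl, -⟩ := A.halts x o ho
  rfl

theorem PolyTime.exists_ppt {μ : Data → PMF Data} (h : PolyTime μ) : ∃ A : PPT, A.out = μ := by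
  obtain ⟨P, p, hP⟩ := h
  refine ⟨⟨P, p, fun x => (hP x _ le_rfl).1⟩, funext fun x => ?_⟩
  have h1 := congrArg (PMF.map fun o : Option Data => o.getD (.num 0)) (hP x _ le_rfl).2
  rw [PMF.map_comp, PMF.map_comp] at h1
  exact h1.trans (PMF.map_id _)

/-- The intermediate output is no longer than the first run, so the second run takes at most `q ∘ p`
steps. -/
theorem PolyTime.comp {μ κ : Data → PMF Data} (hκ : PolyTime κ) (hμ : PolyTime μ) :
    PolyTime fun x => (μ x).bind κ := by
  obtain ⟨P, p, hP⟩ := hμ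
  obtain ⟨Q, q, hQ⟩ := hκ
  refine ⟨.comp P Q, p + q.comp p, fun x T hT => ?_⟩
  simp only [Polynomial.eval_add, Polynomial.eval_comp] at hT ⊢
  refine (hP x T (by lia)).andThen fun y hy => ?_
  have := q.eval_mono_nat ((hP x).size_le hy)
  exact (hQ y T (by lia)).mono this

theorem PolyTime.pair {μ κ : Data → PMF Data} (hμ : PolyTime μ) (hκ : PolyTime κ) :
    PolyTime fun x => (μ x).bind fun a => (κ x).map (Data.pair a) := by
  obtain ⟨P, p, hP⟩ := hμ
  obtain ⟨Q, q, hQ⟩ := hκ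
  refine ⟨.pair P Q, Polynomial.X + 1 + (p + q), fun x T hT => ?_⟩
  simp only [Polynomial.eval_add, Polynomial.eval_X, Polynomial.eval_one] at hT ⊢
  exact ((hP x T (by lia)).andThen fun y hy => (hQ x T (by lia)).map (Data.pair y)).tick _

theorem PolyTime.elementary {f : Data → Data} (P : Prog)
    (hP : ∀ T x, P.run T x = elementary x (f x)) (p : Polynomial ℕ)
    (hp : ∀ x, (f x).size ≤ p.eval x.size) : PolyFun f := by
  refine ⟨P, Polynomial.X + p + 1, fun x T hT => ?_⟩
  rw [hP]
  simp only [Polynomial.eval_add, Polynomial.eval_X, Polynomial.eval_one] at hT ⊢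
  exact (LawWithin.pure (f x) _).mono (by have := hp x; lia)

namespace PolyFun

variable {f g : Data → Data}

@[fun_prop]
theorem id : PolyFun fun x => x :=
  .elementary .id (fun _ _ => rfl) Polynomial.X fun x => by simp


@[fun_prop]
theorem comp (hg : PolyFun g) (hf : PolyFun f) : PolyFun fun x => g (f x) := by
  simpa only [PolyFun, PMF.pure_bind] using PolyTime.comp hg hf

@[fun_prop]
theorem fst (hf : PolyFun f) : PolyFun fun x => (f x).fst :=
  comp (.elementary .fst (fun _ _ => rfl) Polynomial.X fun x => by simpa using x.size_fst_le) hf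

@[fun_prop]
theorem snd (hf : PolyFun f) : PolyFun fun x => (f x).snd :=
  comp (.elementary .snd (fun _ _ => rfl) Polynomial.X fun x => by simpa using x.size_snd_le) hf

@[fun_prop]
theorem isPair (hf : PolyFun f) : PolyFun fun x => (f x).isPair := by
  refine comp (.elementary .isPair (fun _ _ => rfl) 2 fun x => ?_) hf
  cases x <;> simp [Data.isPair, Data.size]

@[fun_prop]
theorem pair (hf : PolyFun f) (hg : PolyFun g) : PolyFun fun x => .pair (f x) (g x) := by
  simpa only [PolyFun, PMF.pure_bind, PMF.pure_map] using PolyTime.pair hf hg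

@[fun_prop]
theorem const (d : Data) : PolyFun fun _ => d := by
  induction d with
  | num n =>
    exact .elementary (.const n) (fun _ _ => rfl) (Polynomial.C (Data.size (.num n)))
      fun x => by simp
  | pair a b ha hb => exact ha.pair hb

end PolyFun

/-! ### Polynomial-time arithmetic -/

theorem Nat.size_add_le (a b : ℕ) : (a + b).size ≤ a.size + b.size + 1 := by
  rw [Nat.size_le, pow_succ, pow_add]
  have ha := Nat.lt_size_self a
  have hb := Nat.lt_size_self b
  nlinarith

theorem Nat.size_mul_le (a b : ℕ) : (a * b).size ≤ a.size + b.size := by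
  rw [Nat.size_le, pow_add]
  exact Nat.mul_lt_mul'' (Nat.lt_size_self a) (Nat.lt_size_self b)

theorem ArithOp.size_eval_le (o : ArithOp) (a b : ℕ) : (o.eval a b).size ≤ a.size + b.size + 1 := by
  cases o
  · exact Nat.size_add_le a b
  · exact (Nat.size_le_size (Nat.sub_le a b)).trans (by lia)
  · exact (Nat.size_mul_le a b).trans (by lia)
  · exact (Nat.size_le_size (Nat.div_le_self a b)).trans (by lia)
  · exact (Nat.size_le_size (Nat.mod_le a b)).trans (by lia)

theorem Data.size_toNat_le (x : Data) : x.toNat.size + 1 ≤ x.size := by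
  cases x <;> simp only [Data.toNat, Data.size, Nat.size_zero] <;> lia

theorem PolyFun.arith {f g : Data → Data} (o : ArithOp) (hf : PolyFun f) (hg : PolyFun g) :
    PolyFun fun x => .num (o.eval (f x).toNat (g x).toNat) := by
  refine comp (g := fun d => .num (o.eval d.fst.toNat d.snd.toNat))
    (.elementary (.arith o) (fun _ _ => rfl) (2 * Polynomial.X + 2) fun x => ?_) (hf.pair hg)
  have h1 := o.size_eval_le x.fst.toNat x.snd.toNat
  have h2 := x.fst.size_toNat_le
  have h3 := x.snd.size_toNat_le
  have h4 := x.size_fst_le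
  have h5 := x.size_snd_le
  simp only [Data.size, Polynomial.eval_add, Polynomial.eval_mul, Polynomial.eval_ofNat,
    Polynomial.eval_X]
  lia

/-- A function into the natural numbers that some program computes in polynomial time. -/
@[fun_prop]
def PolyNat (f : Data → ℕ) : Prop := PolyFun fun x => .num (f x)

@[fun_prop]
theorem PolyFun.num {f : Data → ℕ} (hf : PolyNat f) : PolyFun fun x => .num (f x) := hf

namespace PolyNat

variable {f g : Data → ℕ}

@[fun_prop]
theorem const (n : ℕ) : PolyNat fun _ => n := PolyFun.const (.num n)

@[fun_prop]
theorem toNat {f : Data → Data} (hf : PolyFun f) : PolyNat fun x => (f x).toNat :=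
  PolyFun.arith .add hf (.const (.num 0))

@[fun_prop]
theorem add (hf : PolyNat f) (hg : PolyNat g) : PolyNat fun x => f x + g x :=
  PolyFun.arith .add hf hg

@[fun_prop]
theorem sub (hf : PolyNat f) (hg : PolyNat g) : PolyNat fun x => f x - g x :=
  PolyFun.arith .sub hf hg

@[fun_prop]
theorem mul (hf : PolyNat f) (hg : PolyNat g) : PolyNat fun x => f x * g x :=
  PolyFun.arith .mul hf hg

@[fun_prop]
theorem div (hf : PolyNat f) (hg : PolyNat g) : PolyNat fun x => f x / g x :=
  PolyFun.arith .div hf hg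

@[fun_prop]
theorem mod (hf : PolyNat f) (hg : PolyNat g) : PolyNat fun x => f x % g x :=
  PolyFun.arith .mod hf hg

end PolyNat

/-! ### Sequencing, branching and loops for randomized programs -/

namespace PolyTime

theorem of_fun {μ : Data → PMF Data} {f : Data → Data} (hμ : PolyTime μ) (hf : PolyFun f) :
    PolyTime fun x => μ (f x) := by
  simpa only [PMF.pure_bind] using hμ.comp hf

/-- The continuation also reads the original input, so the first stage returns it paired with its
sample. Iterated binds thus build a left-nested environment. -/
theorem bind {μ : Data → PMF Data} {κ : Data → Data → PMF Data} (hμ : PolyTime μ)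
    (hκ : PolyTime fun d => κ d.fst d.snd) : PolyTime fun x => (μ x).bind (κ x) := by
  have := hκ.comp (PolyTime.pair PolyFun.id hμ)
  simpa only [PMF.pure_bind, PMF.bind_map, Function.comp_def, Data.fst, Data.snd] using this

open Classical in
theorem cond {b : Data → Data} {μ κ : Data → PMF Data} (hb : PolyFun b) (hμ : PolyTime μ)
    (hκ : PolyTime κ) : PolyTime fun x => if b x = .num 0 then μ x else κ x := by
  have h : PolyTime fun x => if x.fst = .num 0 then μ x.snd else κ x.snd := by
    obtain ⟨P, p, hP⟩ := hμ
    obtain ⟨Q, q, hQ⟩ := hκ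
    refine ⟨.cond P Q, Polynomial.X + 1 + (p + q), fun x T hT => ?_⟩
    simp only [Polynomial.eval_add, Polynomial.eval_X, Polynomial.eval_one] at hT ⊢
    have hp := p.eval_mono_nat x.size_snd_le
    have hq := q.eval_mono_nat x.size_snd_le
    refine LawWithin.tick ?_ _
    split_ifs
    · exact (hP _ T (by lia)).mono (by lia)
    · exact (hQ _ T (by lia)).mono (by lia)
  exact h.of_fun (hb.pair PolyFun.id)

open Classical in
/-- A loop runs in polynomial time if an invariant bounds the number of rounds and the size of the
state. -/
theorem loop {β F : Data → PMF Data} (hβ : PolyTime β)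
    (hF : ∀ x, F x = (β x).bind fun y => if y.fst = .num 0 then PMF.pure y.snd else F y.snd)
    (I : ℕ → ℕ → Data → Prop) (s k : Polynomial ℕ)
    (hI : ∀ S j x, I S j x → x.size ≤ S ∧
      ∃ i, j = i + 1 ∧ ∀ y ∈ (β x).support, y.fst = .num 0 ∨ I S i y.snd)
    (h0 : ∀ x, I (s.eval x.size) (k.eval x.size) x) : PolyTime F := by
  obtain ⟨P, p, hP⟩ := hβ
  -- In `I S j x`, `S` bounds the size of the state and `j` the rounds left, with `j = 0`
  -- impossible. A round costs at most `S + 1` for its charge and `p.eval S` for the body.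
  have key : ∀ S T, p.eval S ≤ T → ∀ j i x, I S j x → j ≤ i →
      LawWithin (loopRun (P.run T) i x) (F x) (j * (S + 1 + p.eval S)) := by
    intro S T hT j
    induction j with
    | zero =>
      intro i x hx
      obtain ⟨-, i, hi, -⟩ := hI S 0 x hx
      lia
    | succ j ih =>
      intro i x hx hi
      obtain ⟨hS, j', hj', hy⟩ := hI S _ x hx
      obtain rfl : j = j' := by lia
      obtain ⟨i, rfl⟩ : ∃ i', i = i' + 1 := ⟨i - 1, by lia⟩
      have hp := p.eval_mono_nat hS
      rw [loopRun, hF]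
      refine (((hP x T (hp.trans hT)).andThen (B' := j * (S + 1 + p.eval S))
        fun y hy' => ?_).tick _).mono (by lia)
      split_ifs with h
      · exact (LawWithin.pure _ _).mono (by lia)
      · exact ih i _ ((hy y hy').resolve_left h) (by lia)
  refine ⟨.loop P, k + p.comp s + k * (s + 1 + p.comp s), fun x T hT => ?_⟩
  simp only [Polynomial.eval_add, Polynomial.eval_mul, Polynomial.eval_comp,
    Polynomial.eval_one] at hT ⊢
  exact (key _ T (by lia) _ T x (h0 x) (by lia)).mono (by lia)

end PolyTime

/-! ### Iteration over a list -/

/-- Fold a randomized step over a list, with a fixed context `c`. -/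
def foldRand (f : Data → Data → Data → PMF Data) (c : Data) : Data → Data → PMF Data
  | .num _, a => PMF.pure a
  | .pair e l, a => (f c e a).bind (foldRand f c l)

open Classical in
/-- A fold runs in polynomial time if each step adds to the accumulator only a polynomial amount in
the size of the context and of the list element. -/
theorem PolyTime.fold {f : Data → Data → Data → PMF Data}
    (hf : PolyTime fun x => f x.fst x.snd.fst x.snd.snd) (r : Polynomial ℕ)
    (hr : ∀ c e a, ∀ y ∈ (f c e a).support, y.size ≤ a.size + r.eval (c.size + e.size)) :
    PolyTime fun x => foldRand f x.fst x.snd.fst x.snd.snd := by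
  have hβ : PolyTime fun x => if x.snd.fst.isPair = .num 0 then
      PMF.pure (.pair (.num 0) x.snd.snd)
      else (f x.fst x.snd.fst.fst x.snd.snd).bind fun a =>
        PMF.pure (.pair (.num 1) (.pair x.fst (.pair x.snd.fst.snd a))) := by
    refine .cond (by fun_prop) (show PolyFun _ by fun_prop) (.bind ?_ (show PolyFun _ by fun_prop))
    exact hf.of_fun (f := fun x => .pair x.fst (.pair x.snd.fst.fst x.snd.snd)) (by fun_prop)
  -- The state is `(c, (l, a))`. A round shortens `l` by at least one unit and lengthens `a` by at
  -- most `R`, so the potential `x.size + l.size * R` never grows and bounds every later state.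
  refine hβ.loop (fun x => ?_)
    (fun S j x => x.snd.fst.size ≤ j ∧ ∃ R, r.eval (x.fst.size + x.snd.fst.size) ≤ R ∧
      x.size + x.snd.fst.size * R ≤ S)
    (Polynomial.X + Polynomial.X * r.comp (2 * Polynomial.X)) Polynomial.X ?_ ?_
  · rcases h : x.snd.fst with n | ⟨e, l⟩
    · simp [Data.isPair, foldRand, PMF.pure_bind, Data.fst, Data.snd]
    · simp [Data.isPair, foldRand, PMF.pure_bind, PMF.bind_bind, Data.fst, Data.snd]
  · rintro S j x ⟨hj, R, hR, hS⟩
    refine ⟨by lia, j - 1, ?_, fun y hy => ?_⟩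
    · have : 1 ≤ x.snd.fst.size := by cases x.snd.fst <;> simp [Data.size]
      lia
    · rcases h : x.snd.fst with n | ⟨e, l⟩
      · simp only [h, Data.isPair, if_true, PMF.mem_support_pure_iff] at hy
        left
        rw [hy, Data.fst]
      · right
        rcases x with n | ⟨c, x⟩
        · simp [Data.snd, Data.fst] at h
        rcases x with n | ⟨z, a⟩
        · simp [Data.snd, Data.fst] at h
        simp only [Data.snd, Data.fst] at h hy hj hR hS
        subst h
        simp only [Data.isPair, Data.num.injEq, one_ne_zero, if_false] at hy
        obtain ⟨a', ha', hy⟩ := (PMF.mem_support_bind_iff _ _ _).1 hy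
        rw [PMF.mem_support_pure_iff] at hy
        subst hy
        have h1 := hr _ _ _ _ ha'
        simp only [Data.snd, Data.fst, Data.size] at h1 hj hR hS ⊢
        have h2 := r.eval_mono_nat (a := c.size + e.size) (b := c.size + (e.size + l.size + 1))
          (by lia)
        have h3 := r.eval_mono_nat (a := c.size + l.size) (b := c.size + (e.size + l.size + 1))
          (by lia)
        refine ⟨by lia, R, by lia, ?_⟩
        nlinarith
  · intro x
    have h1 := x.size_fst_le
    have h2 := x.snd.size_fst_le.trans x.size_snd_le
    refine ⟨by simpa using h2, _, le_rfl, ?_⟩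
    have h3 := r.eval_mono_nat (a := x.fst.size + x.snd.fst.size) (b := 2 * x.size) (by lia)
    simp only [Polynomial.eval_add, Polynomial.eval_mul, Polynomial.eval_X, Polynomial.eval_comp,
      Polynomial.eval_ofNat]
    gcongr

/-- Fold a deterministic step over a list, with a fixed context `c`. -/
def foldDet (f : Data → Data → Data → Data) (c l a : Data) : Data :=
  l.toList.foldl (fun b e => f c e b) a

theorem foldRand_pure (f : Data → Data → Data → Data) (c l a : Data) :
    foldRand (fun c e a => PMF.pure (f c e a)) c l a = PMF.pure (foldDet f c l a) := by
  induction l generalizing a with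
  | num n => rfl
  | pair e l _ ih => rw [foldRand, PMF.pure_bind, ih]; rfl

theorem PolyFun.fold {f : Data → Data → Data → Data} {c l a : Data → Data}
    (hf : PolyFun fun x => f x.fst x.snd.fst x.snd.snd) (r : Polynomial ℕ)
    (hr : ∀ c e a, (f c e a).size ≤ a.size + r.eval (c.size + e.size))
    (hc : PolyFun c) (hl : PolyFun l) (ha : PolyFun a) :
    PolyFun fun x => foldDet f (c x) (l x) (a x) := by
  have h := (PolyTime.fold (f := fun c e a => PMF.pure (f c e a)) hf r fun c e a y hy => by
    rw [PMF.mem_support_pure_iff] at hy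
    exact hy ▸ hr c e a).of_fun (f := fun x => .pair (c x) (.pair (l x) (a x))) (by fun_prop)
  simpa only [PolyFun, foldRand_pure, Data.fst, Data.snd] using h

/-- The list `l`, reversed, in front of the list `a`. -/
def Data.revAppend (l a : Data) : Data := foldDet (fun _ e b => .pair e b) (.num 0) l a

theorem Data.length_revAppend (l a : Data) :
    (l.revAppend a).toList.length = l.toList.length + a.toList.length := by
  unfold Data.revAppend foldDet
  generalize l.toList = m
  induction m generalizing a with
  | nil => simp
  | cons e m ih => rw [List.foldl_cons, ih]; simp only [Data.toList, List.length_cons]; lia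

@[fun_prop]
theorem PolyFun.revAppend {l a : Data → Data} (hl : PolyFun l) (ha : PolyFun a) :
    PolyFun fun x => (l x).revAppend (a x) := by
  refine .fold (by fun_prop) (Polynomial.X + 1) (fun c e a => ?_) (.const _) hl ha
  simp only [Data.size, Polynomial.eval_add, Polynomial.eval_X, Polynomial.eval_one]
  lia

@[fun_prop]
theorem PolyNat.length {l : Data → Data} (hl : PolyFun l) :
    PolyNat fun x => (l x).toList.length := by
  have h : ∀ (m : List Data) (n : ℕ),
      m.foldl (fun b _ => Data.num (b.toNat + 1)) (.num n) = .num (m.length + n) := by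
    intro m
    induction m with
    | nil => simp
    | cons e m ih => intro n; rw [List.foldl_cons, ih, List.length_cons, Data.toNat]; congr 1; lia
  have h2 : PolyFun fun x =>
      foldDet (fun _ _ b => .num (b.toNat + 1)) (.num 0) (l x) (.num 0) := by
    refine .fold (by fun_prop) 2 (fun c e a => ?_) (.const _) hl (.const _)
    have h1 := Nat.size_add_le a.toNat 1
    have h2 := a.size_toNat_le
    rw [Nat.size_one] at h1
    simp only [Data.size, Polynomial.eval_ofNat]
    lia
  simpa only [foldDet, h, add_zero, PolyNat] using h2

/-! ### Binary expansion and modular exponentiation -/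

/-- The binary digits of `n`, most significant digit first, in front of the list `a`. -/
def binaryDigits (n : ℕ) (a : Data) : Data :=
  if h : n = 0 then a else binaryDigits (n / 2) (.pair (.num (n % 2)) a)
termination_by n
decreasing_by lia

theorem binaryDigits_zero (a : Data) : binaryDigits 0 a = a := by
  rw [binaryDigits, dif_pos rfl]

theorem binaryDigits_of_ne_zero {n : ℕ} (h : n ≠ 0) (a : Data) :
    binaryDigits n a = binaryDigits (n / 2) (.pair (.num (n % 2)) a) := by
  rw [binaryDigits, dif_neg h]

/-- Each digit halves `n`, and `n + 1 ≤ 2 * (n / 2 + 1)`. The digit list serves as a unary number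
large enough to count the coins for sampling modulo `n`. -/
theorem le_two_pow_length_binaryDigits (n : ℕ) (a : Data) :
    (n + 1) * 2 ^ a.toList.length ≤ 2 ^ (binaryDigits n a).toList.length := by
  induction n using Nat.strong_induction_on generalizing a with
  | _ n ih =>
    by_cases h : n = 0
    · subst h
      rw [binaryDigits_zero]
      lia
    · rw [binaryDigits_of_ne_zero h]
      refine le_trans ?_ (ih (n / 2) (by lia) _)
      rw [Data.toList, List.length_cons, pow_succ, mul_comm _ 2, ← mul_assoc]
      exact Nat.mul_le_mul_right _ (by lia)

open Classical in
@[fun_prop]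
theorem PolyFun.binaryDigits {f a : Data → Data} (hf : PolyFun f) (ha : PolyFun a) :
    PolyFun fun x => binaryDigits (f x).toNat (a x) := by
  have h : PolyFun fun x => _root_.binaryDigits x.fst.toNat x.snd := by
    have hβ : PolyTime fun x => if Data.num x.fst.toNat = .num 0 then
        PMF.pure (.pair (.num 0) x.snd)
        else PMF.pure (.pair (.num 1)
          (.pair (.num (x.fst.toNat / 2)) (.pair (.num (x.fst.toNat % 2)) x.snd))) :=
      .cond (by fun_prop) (show PolyFun _ by fun_prop) (show PolyFun _ by fun_prop)
    -- `i` bounds the digits left, with one more round to detect zero. A round adds at most `3` to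
    -- the size: a pair node and a leaf of size at most `2`.
    refine hβ.loop (fun x => ?_)
      (fun S j x => ∃ i, j = i + 1 ∧ x.fst.toNat < 2 ^ i ∧ x.size + 3 * i ≤ S)
      (4 * Polynomial.X) (Polynomial.X + 1) ?_ ?_
    · by_cases h : x.fst.toNat = 0
      · simp [h, binaryDigits_zero, PMF.pure_bind]
      · simp [h, binaryDigits_of_ne_zero h, PMF.pure_bind]
    · rintro S j x ⟨i, rfl, h1, h2⟩
      refine ⟨by lia, i, rfl, fun y hy => ?_⟩
      by_cases h : x.fst.toNat = 0
      · rw [if_pos (by rw [h]), PMF.mem_support_pure_iff] at hy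
        exact .inl (by rw [hy, Data.fst])
      · rw [if_neg (by simpa using h), PMF.mem_support_pure_iff] at hy
        subst hy
        right
        obtain ⟨i, rfl⟩ : ∃ i', i = i' + 1 := by
          cases i with
          | zero => simp at h1; lia
          | succ i => exact ⟨i, rfl⟩
        refine ⟨i, rfl, ?_, ?_⟩
        · simp only [Data.snd_pair, Data.fst_pair, Data.toNat_num]
          rw [pow_succ] at h1
          lia
        · rcases x with n | ⟨n | ⟨b, c⟩, a⟩
          · simp [Data.fst, Data.toNat] at h
          · simp only [Data.snd, Data.fst, Data.toNat, Data.size] at h2 ⊢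
            have h3 : (n / 2).size ≤ n.size := Nat.size_le_size (Nat.div_le_self n 2)
            have h4 : (n % 2).size ≤ 1 := Nat.size_le.2 (by lia)
            lia
          · simp [Data.fst, Data.toNat] at h
    · intro x
      refine ⟨x.size, by simp, ?_, by simp; lia⟩
      refine Nat.size_le.1 (le_trans ?_ x.size_fst_le)
      have := x.fst.size_toNat_le
      lia
  exact h.comp (hf.pair ha)

/-- The positive number `q`, or `1` in place of `0`. -/
def atLeastOne (q : ℕ) : ℕ := q + (1 - q)

theorem atLeastOne_pos (q : ℕ) : 0 < atLeastOne q := by unfold atLeastOne; lia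

theorem atLeastOne_of_ne_zero {q : ℕ} (h : q ≠ 0) : atLeastOne q = q := by unfold atLeastOne; lia

@[fun_prop]
theorem PolyNat.atLeastOne {f : Data → ℕ} (hf : PolyNat f) : PolyNat fun x => atLeastOne (f x) := by
  unfold _root_.atLeastOne
  fun_prop

/-- Size bounds must hold on every input, but `n % 0 = n` is not bounded in terms of the modulus;
hence the guard. -/
theorem size_mod_atLeastOne_le (n : ℕ) (q : Data) :
    (Data.num (n % atLeastOne q.toNat)).size ≤ q.size + 1 := by
  have h1 : (n % atLeastOne q.toNat).size ≤ (q.toNat + 1).size := by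
    refine Nat.size_le_size ((Nat.mod_lt _ (atLeastOne_pos _)).le.trans ?_)
    unfold atLeastOne
    lia
  have h2 : (q.toNat + 1).size ≤ q.toNat.size + 1 := by
    rw [Nat.size_le, pow_succ]
    have := Nat.lt_size_self q.toNat
    lia
  have h3 := q.size_toNat_le
  rw [Data.size]
  lia

/-- One step of square and multiply: the context is `(b, q)`. -/
def powStep (c e a : Data) : Data :=
  .num (a.toNat * a.toNat * (e.toNat * c.fst.toNat + (1 - e.toNat)) % atLeastOne c.snd.toNat)

/-- The power `b ^ n` modulo `q` by square and multiply. -/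
def powMod (b n q : ℕ) : ℕ :=
  (foldDet powStep (.pair (.num b) (.num q)) (binaryDigits n (.num 0)) (.num 1)).toNat

@[fun_prop]
theorem PolyNat.powMod {b n q : Data → ℕ} (hb : PolyNat b) (hn : PolyNat n) (hq : PolyNat q) :
    PolyNat fun x => powMod (b x) (n x) (q x) := by
  refine .toNat (.fold (by unfold powStep; fun_prop) (Polynomial.X + 1) (fun c e a => ?_)
    (by fun_prop) (PolyFun.binaryDigits (f := fun x => .num (n x)) hn (.const _)) (by fun_prop))
  refine (size_mod_atLeastOne_le _ c.snd).trans ?_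
  have := c.size_snd_le
  simp only [Polynomial.eval_add, Polynomial.eval_X, Polynomial.eval_one]
  lia

/-- Horner's rule in the exponent, `n = 2 * (n / 2) + n % 2`. The factor `e * b + (1 - e)` in
`powStep` is `b ^ e` for a digit `e`. -/
theorem exists_foldDet_binaryDigits (b q n : ℕ) (hq : q ≠ 0) (a : Data) :
    ∃ v : ℕ, (v : ZMod q) = (b : ZMod q) ^ n ∧
      foldDet powStep (.pair (.num b) (.num q)) (binaryDigits n a) (.num 1) =
        foldDet powStep (.pair (.num b) (.num q)) a (.num v) := by
  induction n using Nat.strong_induction_on generalizing a with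
  | _ n ih =>
    by_cases h : n = 0
    · subst h
      exact ⟨1, by simp, by rw [binaryDigits_zero]⟩
    · obtain ⟨v, hv, e⟩ := ih (n / 2) (by lia) (.pair (.num (n % 2)) a)
      rw [binaryDigits_of_ne_zero h, e]
      refine ⟨v * v * (n % 2 * b + (1 - n % 2)) % q, ?_, ?_⟩
      · rw [ZMod.natCast_mod, Nat.cast_mul, Nat.cast_mul, hv, ← pow_add]
        rcases Nat.mod_two_eq_zero_or_one n with h2 | h2
        · rw [h2]
          simp only [zero_mul, zero_add, Nat.sub_zero, Nat.cast_one, mul_one]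
          congr 1
          lia
        · rw [h2]
          simp only [one_mul, Nat.sub_self, add_zero]
          rw [← pow_succ]
          congr 1
          lia
      · simp only [foldDet, Data.toList, List.foldl_cons, powStep, Data.fst, Data.snd, Data.toNat,
          atLeastOne_of_ne_zero hq]

theorem powMod_cast (b n q : ℕ) (hq : q ≠ 0) : (powMod b n q : ZMod q) = (b : ZMod q) ^ n := by
  obtain ⟨v, hv, e⟩ := exists_foldDet_binaryDigits b q n hq (.num 0)
  rw [powMod, e, ← hv]
  rfl

/-! ### Sampling residues -/

/-- Toss as many coins as `k` has elements and reduce the resulting number modulo `q`. -/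
def sampleMod (k q : Data) : PMF Data :=
  (uniformBits k.toList.length).map fun r => .num (r % atLeastOne q.toNat)

theorem size_le_of_mem_support_sampleMod {k q y : Data} (h : y ∈ (sampleMod k q).support) :
    y.size ≤ q.size + 1 := by
  obtain ⟨r, -, rfl⟩ := (PMF.mem_support_map_iff _ _ _).1 h
  exact size_mod_atLeastOne_le r q

/-- Tossing `k` coins costs `k` steps, which is exponential in the binary length of `k`. The number
of coins is therefore given as the length of a list. -/
theorem PolyTime.uniformBits_length : PolyTime fun k =>
    (uniformBits k.toList.length).map Data.num := by
  obtain ⟨P, p, hP⟩ := PolyNat.length PolyFun.id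
  refine ⟨.comp P .coins, p + (p + Polynomial.X + 1), fun x T hT => ?_⟩
  simp only [Polynomial.eval_add, Polynomial.eval_X, Polynomial.eval_one] at hT ⊢
  have h := (hP x T (by lia)).andThen (k := Prog.coins.run T)
    (κ := fun y => (uniformBits y.toNat).map Data.num) (B' := p.eval x.size + x.size + 1)
    fun y hy => ?_
  · rw [PMF.pure_bind] at h
    exact h
  · have hs := (hP x).size_le hy
    rw [PMF.mem_support_pure_iff] at hy
    subst hy
    have hl : ∀ d : Data, d.toList.length ≤ d.size := by
      intro d
      induction d with
      | num n => simp [Data.toList]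
      | pair e l _ ih => simp only [Data.toList, List.length_cons, Data.size]; lia
    have := hl x
    rw [Prog.run_coins, Data.toNat]
    refine ⟨fun o ho => ?_, ?_⟩
    · obtain ⟨r, -, rfl⟩ := (PMF.mem_support_map_iff _ _ _).1 ho
      exact ⟨_, _, rfl, by lia⟩
    · rw [PMF.map_comp, PMF.map_comp]
      rfl

theorem PolyTime.sampleMod {k q : Data → Data} (hk : PolyFun k) (hq : PolyFun q) :
    PolyTime fun x => sampleMod (k x) (q x) := by
  have h : PolyTime fun x => (PMF.map Data.num (uniformBits (k x).toList.length)).bind fun r =>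
      PMF.pure (.num (r.toNat % atLeastOne (q x).toNat)) :=
    .bind (uniformBits_length.of_fun hk) (show PolyFun _ by fun_prop)
  simp only [PMF.bind_map, Function.comp_def, Data.toNat_num] at h
  exact h

/-- As many samples from `sampleMod k q` as the list `l` has elements. -/
def sampleModList (k q l : Data) : PMF Data :=
  foldRand (fun c _ a => (sampleMod c.fst c.snd).bind fun r => PMF.pure (.pair r a))
    (.pair k q) l (.num 0)

theorem PolyTime.sampleModList {k q l : Data → Data} (hk : PolyFun k) (hq : PolyFun q)
    (hl : PolyFun l) : PolyTime fun x => sampleModList (k x) (q x) (l x) := by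
  have h := PolyTime.fold
    (f := fun c _ a => (_root_.sampleMod c.fst c.snd).bind fun r => PMF.pure (.pair r a))
    (.bind (.sampleMod (by fun_prop) (by fun_prop)) (show PolyFun _ by fun_prop))
    (Polynomial.X + 2) fun c e a y hy => by
      obtain ⟨r, hr, hy⟩ := (PMF.mem_support_bind_iff _ _ _).1 hy
      rw [PMF.mem_support_pure_iff] at hy
      subst hy
      have h1 := size_le_of_mem_support_sampleMod hr
      have h2 := c.size_snd_le
      simp only [Data.size, Polynomial.eval_add, Polynomial.eval_X, Polynomial.eval_ofNat]
      lia
  have h2 := h.of_fun (f := fun x => .pair (.pair (k x) (q x)) (.pair (l x) (.num 0)))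
    (by fun_prop)
  exact h2

/-! ### Expectations -/

open scoped ENNReal

namespace PMF

variable {α β : Type*}

/-- The expectation of a nonnegative function. -/
def expect (μ : PMF α) (f : α → ℝ≥0∞) : ℝ≥0∞ := ∑' a, μ a * f a

theorem bind_apply_eq_expect (μ : PMF α) (κ : α → PMF β) (b : β) :
    μ.bind κ b = μ.expect fun a => κ a b := rfl

theorem expect_mono (μ : PMF α) {f g : α → ℝ≥0∞} (h : ∀ a, f a ≤ g a) :
    μ.expect f ≤ μ.expect g :=
  ENNReal.tsum_le_tsum fun a => mul_le_mul_right (h a) _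

theorem expect_const (μ : PMF α) (c : ℝ≥0∞) : (μ.expect fun _ => c) = c := by
  rw [expect, ENNReal.tsum_mul_right, tsum_coe, one_mul]

theorem expect_add (μ : PMF α) (f g : α → ℝ≥0∞) :
    (μ.expect fun a => f a + g a) = μ.expect f + μ.expect g := by
  simp only [expect, mul_add, ENNReal.tsum_add]

theorem expect_const_mul (μ : PMF α) (c : ℝ≥0∞) (f : α → ℝ≥0∞) :
    (μ.expect fun a => c * f a) = c * μ.expect f := by
  simp only [expect, mul_left_comm _ c, ENNReal.tsum_mul_left]

theorem expect_mul_const (μ : PMF α) (c : ℝ≥0∞) (f : α → ℝ≥0∞) :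
    (μ.expect fun a => f a * c) = μ.expect f * c := by
  simp only [mul_comm _ c, expect_const_mul]

theorem expect_comm (μ : PMF α) (ν : PMF β) (f : α → β → ℝ≥0∞) :
    (μ.expect fun a => ν.expect (f a)) = ν.expect fun b => μ.expect fun a => f a b := by
  simp only [expect, ← ENNReal.tsum_mul_left]
  rw [ENNReal.tsum_comm]
  simp only [mul_left_comm]

theorem expect_pure (a : α) (f : α → ℝ≥0∞) : (pure a).expect f = f a := by
  rw [expect, tsum_eq_single a]
  · rw [pure_apply_self, one_mul]
  · intro b hb
    rw [pure_apply_of_ne _ _ hb, zero_mul]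

theorem expect_bind (μ : PMF α) (κ : α → PMF β) (f : β → ℝ≥0∞) :
    (μ.bind κ).expect f = μ.expect fun a => (κ a).expect f := by
  simp only [expect, bind_apply, ← ENNReal.tsum_mul_left, ← ENNReal.tsum_mul_right]
  rw [ENNReal.tsum_comm]
  simp only [mul_assoc]

theorem expect_map (μ : PMF α) (g : α → β) (f : β → ℝ≥0∞) :
    (μ.map g).expect f = μ.expect fun a => f (g a) := by
  rw [map, expect_bind]
  simp only [Function.comp_apply, expect_pure]

theorem expect_le_one (μ : PMF α) {f : α → ℝ≥0∞} (h : ∀ a, f a ≤ 1) : μ.expect f ≤ 1 :=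
  (μ.expect_mono h).trans (μ.expect_const 1).le

theorem expect_mul_expect (μ : PMF α) (ν : PMF β) (f : α → ℝ≥0∞) (g : β → ℝ≥0∞) :
    μ.expect f * ν.expect g = μ.expect fun a => ν.expect fun b => f a * g b := by
  simp only [expect_const_mul, expect_mul_const]

end PMF

theorem ENNReal.two_mul_mul_le (a b : ℝ≥0∞) : 2 * (a * b) ≤ a ^ 2 + b ^ 2 := by
  wlog h : a ≤ b generalizing a b
  · rw [mul_comm a, add_comm]
    exact this b a (le_of_not_ge h)
  -- With `b = a + d` the difference of the two sides is `d ^ 2`, so no subtraction is needed.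
  · obtain ⟨d, rfl⟩ := exists_add_of_le h
    calc 2 * (a * (a + d)) ≤ 2 * (a * (a + d)) + d ^ 2 := le_self_add
      _ = a ^ 2 + (a + d) ^ 2 := by ring

theorem ENNReal.add_sq_le (a b : ℝ≥0∞) : (a + b) ^ 2 ≤ 2 * a ^ 2 + 2 * b ^ 2 := by
  calc (a + b) ^ 2 = a ^ 2 + b ^ 2 + 2 * (a * b) := by ring
    _ ≤ a ^ 2 + b ^ 2 + (a ^ 2 + b ^ 2) := by gcongr; exact two_mul_mul_le a b
    _ = 2 * a ^ 2 + 2 * b ^ 2 := by ring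

/-! ### Jensen's inequality, forking and domination of distributions -/

namespace PMF

variable {α β : Type*}

/-- The square is an expectation over two independent copies; apply `2xy ≤ x² + y²` to the product.
-/
theorem sq_expect_le (μ : PMF α) (f : α → ℝ≥0∞) :
    μ.expect f ^ 2 ≤ μ.expect fun a => f a ^ 2 := by
  have h : 2 * μ.expect f ^ 2 ≤ 2 * μ.expect fun a => f a ^ 2 := by
    rw [sq, expect_mul_expect, ← expect_const_mul]
    simp only [← expect_const_mul]
    calc (μ.expect fun a => μ.expect fun b => 2 * (f a * f b))
        ≤ μ.expect fun a => μ.expect fun b => f a ^ 2 + f b ^ 2 :=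
          expect_mono _ fun a => expect_mono _ fun b => ENNReal.two_mul_mul_le _ _
      _ = μ.expect fun a => 2 * f a ^ 2 := by
          simp only [expect_add, expect_const, expect_const_mul]
          ring
  exact (ENNReal.mul_le_mul_iff_right two_ne_zero ENNReal.ofNat_ne_top).1 h

theorem expect_pow_four_le (μ : PMF α) (f : α → ℝ≥0∞) :
    μ.expect f ^ 4 ≤ μ.expect fun a => f a ^ 4 := by
  calc μ.expect f ^ 4 = (μ.expect f ^ 2) ^ 2 := by ring
    _ ≤ (μ.expect fun a => f a ^ 2) ^ 2 := by gcongr; exact sq_expect_le μ f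
    _ ≤ μ.expect fun a => (f a ^ 2) ^ 2 := sq_expect_le _ _
    _ = μ.expect fun a => f a ^ 4 := by simp only [← pow_mul]

open Classical in
/-- Two independent uniform samples both succeed and are distinct with probability at least the
square of the success probability, up to the collision probability. -/
theorem sq_expect_uniform_le [Fintype α] [Nonempty α] {f : α → ℝ≥0∞} (hf : ∀ a, f a ≤ 1) :
    (uniformOfFintype α).expect f ^ 2 ≤
      ((uniformOfFintype α).expect fun a => (uniformOfFintype α).expect fun b =>
        if a = b then 0 else f a * f b) + (Fintype.card α : ℝ≥0∞)⁻¹ := by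
  set μ := uniformOfFintype α
  have h : ∀ a, (μ.expect fun b => if a = b then 1 else 0) = (Fintype.card α : ℝ≥0∞)⁻¹ := by
    intro a
    simp only [expect, mul_ite, mul_one, mul_zero, tsum_ite_eq', μ]
    exact uniformOfFintype_apply a
  calc μ.expect f ^ 2
      ≤ μ.expect fun a => μ.expect fun b =>
          (if a = b then 0 else f a * f b) + if a = b then 1 else 0 := by
        rw [sq, expect_mul_expect]
        refine expect_mono _ fun a => expect_mono _ fun b => ?_
        split_ifs
        · rw [zero_add]
          exact mul_le_one' (hf a) (hf b)
        · rw [add_zero]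
    _ = _ := by simp only [expect_add, h, expect_const]

/-- `μ` is bounded by `θ⁻¹ * ν`. -/
def Dominates (θ : ℝ≥0∞) (μ ν : PMF α) : Prop := ∀ a, θ * μ a ≤ ν a

theorem Dominates.refl (μ : PMF α) : Dominates 1 μ μ := fun _ => (one_mul _).le

/-- Pointwise lower bounds multiply along an experiment, so replacing a sampler costs one factor per
draw. -/
theorem Dominates.bind {θ θ' : ℝ≥0∞} {μ ν : PMF α} {κ κ' : α → PMF β} (h : Dominates θ μ ν)
    (h' : ∀ a, Dominates θ' (κ a) (κ' a)) : Dominates (θ * θ') (μ.bind κ) (ν.bind κ') := by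
  intro b
  rw [bind_apply, bind_apply, ← ENNReal.tsum_mul_left]
  refine ENNReal.tsum_le_tsum fun a => ?_
  calc θ * θ' * (μ a * κ a b) = (θ * μ a) * (θ' * κ a b) := by ring
    _ ≤ ν a * κ' a b := mul_le_mul' (h a) (h' a b)

theorem Dominates.bind_right {θ : ℝ≥0∞} (μ : PMF α) {κ κ' : α → PMF β}
    (h' : ∀ a, Dominates θ (κ a) (κ' a)) :
    Dominates θ (μ.bind κ) (μ.bind κ') := by
  simpa only [one_mul] using (Dominates.refl μ).bind h'

end PMF

/-! ### Independent samples -/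

theorem sampleList_snoc {α : Type} (μ : PMF α) (k : ℕ) :
    sampleList μ (k + 1) =
      (sampleList μ k).bind fun l => μ.bind fun a => PMF.pure (l ++ [a]) := by
  induction k with
  | zero => simp [sampleList, PMF.pure_bind]
  | succ k ih =>
    rw [sampleList]
    conv_lhs => rw [ih]
    conv_rhs => rw [sampleList]
    simp only [PMF.bind_bind, PMF.pure_bind, List.cons_append]

/-- Independent samples are exchangeable. This is needed because a fold that prepends its samples
returns them in reverse order. -/
theorem sampleList_map_reverse {α : Type} (μ : PMF α) (k : ℕ) :
    (sampleList μ k).map List.reverse = sampleList μ k := by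
  induction k with
  | zero => simp [sampleList, PMF.pure_map]
  | succ k ih =>
    conv_rhs => rw [sampleList_snoc, ← ih, PMF.bind_map]
    simp only [sampleList, PMF.map_bind, PMF.pure_map, List.reverse_cons, Function.comp_def]
    rw [PMF.bind_comm]

theorem sampleList_map {α β : Type} (μ : PMF α) (f : α → β) (k : ℕ) :
    sampleList (μ.map f) k = (sampleList μ k).map (List.map f) := by
  induction k with
  | zero => simp [sampleList, PMF.pure_map]
  | succ k ih =>
    simp only [sampleList, ih, PMF.map_bind, PMF.bind_map, PMF.pure_map, Function.comp_def,
      List.map_cons]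

theorem foldRand_cons (μ : PMF Data) (c l : Data) (a : List Data) :
    foldRand (fun _ _ a => μ.bind fun r => PMF.pure (.pair r a)) c l (.ofList a) =
      (sampleList μ l.toList.length).map fun w => .ofList (w.reverse ++ a) := by
  induction l generalizing a with
  | num n => simp [foldRand, Data.toList, sampleList, PMF.pure_map]
  | pair e l _ ih =>
    have ih' := fun r => ih (r :: a)
    simp only [Data.ofList] at ih'
    simp only [foldRand, PMF.bind_bind, PMF.pure_bind, ih', Data.toList, List.length_cons,
      sampleList, PMF.map_bind, PMF.pure_map, List.reverse_cons, List.append_assoc,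
      List.cons_append, List.nil_append]
    rfl

theorem foldRand_cons_nil (μ : PMF Data) (c l : Data) :
    foldRand (fun _ _ a => μ.bind fun r => PMF.pure (.pair r a)) c l (.num 0) =
      (sampleList μ l.toList.length).map Data.ofList := by
  have h := foldRand_cons μ c l []
  simp only [List.append_nil] at h
  conv_rhs => rw [← sampleList_map_reverse, PMF.map_comp]
  exact h

/-! ### Comparison of `sampleMod` with uniform samples -/

/-- A uniform residue modulo `q`, as a datum. -/
def uniformMod (q : ℕ) [NeZero q] : PMF Data :=
  (PMF.uniformOfFintype (ZMod q)).map fun r => .num r.val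

/-- The numbers `v + q * j` with `j < N / q` are distinct, below `N` and congruent to `v`. -/
theorem card_le_card_filter_mod_eq (N q v : ℕ) (hv : v < q) :
    N / q ≤ (Finset.univ.filter fun i : Fin N => (i : ℕ) % q = v).card := by
  have hlt : ∀ j : Fin (N / q), v + q * j < N := fun j => by
    have h1 : q * (j + 1) ≤ q * (N / q) := Nat.mul_le_mul_left _ j.isLt
    have h2 := Nat.mul_div_le N q
    lia
  have hq : 0 < q := by lia
  have h := Finset.card_le_card_of_injOn (s := (Finset.univ : Finset (Fin (N / q))))
    (t := Finset.univ.filter fun i : Fin N => (i : ℕ) % q = v)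
    (fun j => ⟨v + q * j, hlt j⟩) (fun j _ => by simp [Nat.mod_eq_of_lt hv]) fun i _ j _ e => by
      simp only [Fin.mk.injEq] at e
      exact Fin.ext (Nat.eq_of_mul_eq_mul_left hq (by lia))
  simpa using h

theorem PMF.map_uniformOfFintype_apply {α β : Type*} [Fintype α] [Nonempty α] [DecidableEq β]
    (f : α → β) (b : β) : (uniformOfFintype α).map f b =
      (Finset.univ.filter fun a => f a = b).card * (Fintype.card α : ℝ≥0∞)⁻¹ := by
  rw [map_apply, tsum_fintype, Finset.sum_congr rfl (g := fun a =>
    if f a = b then (Fintype.card α : ℝ≥0∞)⁻¹ else 0), ← Finset.sum_filter, Finset.sum_const,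
    nsmul_eq_mul]
  intro a _
  rw [uniformOfFintype_apply]
  split_ifs with h1 h2 h2
  · rfl
  · exact absurd h1.symm h2
  · exact absurd h2.symm h1
  · rfl

/-- Of the `N` bit strings at least `⌊N / q⌋` reduce to a given residue, and `q * ⌊N / q⌋ / N ≥ 1 -
q / N ≥ 1 - 2⁻ᵐ`. -/
theorem dominates_sampleMod {q : ℕ} [NeZero q] {k : Data} {m : ℕ}
    (h : q * 2 ^ m ≤ 2 ^ k.toList.length) :
    PMF.Dominates (1 - (2 ^ m)⁻¹) (uniformMod q) (sampleMod k (.num q)) := by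
  classical
  intro a
  by_cases ha : a ∈ (uniformMod q).support
  swap
  · rw [(PMF.apply_eq_zero_iff _ a).2 ha, mul_zero]
    exact zero_le
  obtain ⟨r, -, rfl⟩ := (PMF.mem_support_map_iff _ _ _).1 ha
  have h1 : uniformMod q (.num r.val) = (q : ℝ≥0∞)⁻¹ := by
    rw [uniformMod, PMF.map_uniformOfFintype_apply, ZMod.card]
    have : (Finset.univ.filter fun s : ZMod q => Data.num s.val = .num r.val) = {r} := by
      ext s
      simp [(ZMod.val_injective q).eq_iff]
    rw [this, Finset.card_singleton, Nat.cast_one, one_mul]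
  rw [h1, sampleMod, uniformBits, PMF.map_comp, PMF.map_uniformOfFintype_apply, Data.toNat_num,
    atLeastOne_of_ne_zero (NeZero.ne q), Fintype.card_fin]
  set N := 2 ^ k.toList.length
  have h2 : N / q ≤ (Finset.univ.filter fun i : Fin N =>
      ((fun i : ℕ => Data.num (i % q)) ∘ fun i : Fin N => (i : ℕ)) i = .num r.val).card := by
    simpa using card_le_card_filter_mod_eq N q r.val (ZMod.val_lt r)
  have hq0 : (q : ℝ≥0∞) ≠ 0 := by simp [NeZero.ne q]
  have hN0 : (N : ℝ≥0∞) ≠ 0 := by simp [N]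
  have hNt : (N : ℝ≥0∞) ≠ ⊤ := ENNReal.natCast_ne_top N
  have hqt : (q : ℝ≥0∞) ≠ ⊤ := ENNReal.natCast_ne_top q
  refine le_trans ?_ (mul_le_mul_left (Nat.cast_le.2 h2) _)
  have h3 : (q : ℝ≥0∞) * (N : ℝ≥0∞)⁻¹ ≤ (2 ^ m)⁻¹ := by
    rw [ENNReal.le_inv_iff_mul_le, mul_right_comm, ← div_eq_mul_inv]
    refine ENNReal.div_le_of_le_mul ?_
    rw [one_mul]
    exact_mod_cast h
  have h4 : (N : ℝ≥0∞) ≤ q * (N / q : ℕ) + q := by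
    have := Nat.lt_mul_div_succ N (NeZero.pos q)
    rw [mul_add, mul_one] at this
    exact_mod_cast this.le
  have h5 : 1 - (2 ^ m)⁻¹ ≤ (q : ℝ≥0∞) * (N / q : ℕ) * (N : ℝ≥0∞)⁻¹ := by
    rw [tsub_le_iff_right]
    calc (1 : ℝ≥0∞) = N * (N : ℝ≥0∞)⁻¹ := (ENNReal.mul_inv_cancel hN0 hNt).symm
      _ ≤ (q * (N / q : ℕ) + q) * (N : ℝ≥0∞)⁻¹ := by gcongr
      _ = (q : ℝ≥0∞) * (N / q : ℕ) * (N : ℝ≥0∞)⁻¹ + q * (N : ℝ≥0∞)⁻¹ := add_mul _ _ _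
      _ ≤ _ := by gcongr
  calc (1 - (2 ^ m)⁻¹) * (q : ℝ≥0∞)⁻¹
      ≤ (q : ℝ≥0∞) * (N / q : ℕ) * (N : ℝ≥0∞)⁻¹ * (q : ℝ≥0∞)⁻¹ := by gcongr
    _ = (q : ℝ≥0∞) * (q : ℝ≥0∞)⁻¹ * ((N / q : ℕ) * (N : ℝ≥0∞)⁻¹) := by ring
    _ = _ := by rw [ENNReal.mul_inv_cancel hq0 hqt, one_mul]

/-- Bernoulli's inequality together with `2 * m ≤ 2 ^ m`. -/
theorem inv_two_le_pow {m : ℕ} : (2 : ℝ≥0∞)⁻¹ ≤ (1 - (2 ^ m)⁻¹) ^ m := by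
  have h1 : (1 : ℝ) / 2 ≤ (1 - (2 ^ m)⁻¹) ^ m := by
    have h2 : (m : ℝ) * (2 ^ m)⁻¹ ≤ 1 / 2 := by
      rw [← div_eq_mul_inv, div_le_div_iff₀ (by positivity) two_pos]
      have : m * 2 ≤ 1 * 2 ^ m := by
        cases m with
        | zero => simp
        | succ m => have := Nat.lt_two_pow_self (n := m); rw [pow_succ]; lia
      exact_mod_cast this
    have h3 : ((2 : ℝ) ^ m)⁻¹ ≤ 1 := inv_le_one_of_one_le₀ (one_le_pow₀ one_le_two)
    have h4 := one_add_mul_le_pow (a := -((2 : ℝ) ^ m)⁻¹) (by linarith) m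
    rw [← sub_eq_add_neg] at h4
    linarith
  have h5 := ENNReal.ofReal_le_ofReal h1
  have h3 : ((2 : ℝ) ^ m)⁻¹ ≤ 1 := inv_le_one_of_one_le₀ (one_le_pow₀ one_le_two)
  rw [ENNReal.ofReal_pow (by linarith), ENNReal.ofReal_sub _ (by positivity),
    ENNReal.ofReal_inv_of_pos (by positivity), ENNReal.ofReal_pow (by norm_num), one_div,
    ENNReal.ofReal_inv_of_pos two_pos, ENNReal.ofReal_one, ENNReal.ofReal_ofNat] at h5
  exact h5

theorem dominates_sampleModList {q : ℕ} [NeZero q] {k : Data} {θ : ℝ≥0∞}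
    (h : PMF.Dominates θ (uniformMod q) (sampleMod k (.num q))) (l : Data) :
    PMF.Dominates (θ ^ l.toList.length)
      ((sampleList (PMF.uniformOfFintype (ZMod q)) l.toList.length).map fun w =>
        .ofList (w.map fun r => .num r.val))
      (sampleModList k (.num q) l) := by
  have h1 : ((sampleList (PMF.uniformOfFintype (ZMod q)) l.toList.length).map fun w =>
      Data.ofList (w.map fun r => .num r.val)) =
      foldRand (fun _ _ a => (uniformMod q).bind fun r => PMF.pure (.pair r a))
        (.pair k (.num q)) l (.num 0) := by
    rw [foldRand_cons_nil, uniformMod, sampleList_map, PMF.map_comp]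
    rfl
  rw [h1, sampleModList]
  clear h1
  generalize Data.num 0 = a
  induction l generalizing a with
  | num n => simpa only [Data.toList, List.length_nil, pow_zero, foldRand] using PMF.Dominates.refl _
  | pair e l _ ih =>
    rw [foldRand, foldRand, Data.toList, List.length_cons, pow_succ']
    have h2 := (h.bind (κ := fun r => PMF.pure (Data.pair r a)) fun r => .refl _).bind
      fun b => ih b
    rw [mul_one] at h2
    exact h2

/-! ### Negligible functions -/

theorem Negligible.mono {f g : ℕ → ℝ} (hg : Negligible g) (hf : ∀ n, 0 ≤ f n)
    (h : ∀ n, f n ≤ g n) : Negligible f :=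
  Asymptotics.SuperpolynomialDecay.trans_abs_le hg fun n => by
    rw [abs_of_nonneg (hf n), abs_of_nonneg ((hf n).trans (h n))]
    exact h n

theorem negligible_zero : Negligible fun _ => 0 :=
  Asymptotics.superpolynomialDecay_zero _ _

/-- Apply the hypothesis with the exponent `4 * k` and take two square roots. -/
theorem Negligible.of_pow_four {f : ℕ → ℝ} (hf : ∀ n, 0 ≤ f n)
    (h : Negligible fun n => f n ^ 4) : Negligible f := by
  intro k
  have h1 := (Real.continuous_sqrt.comp Real.continuous_sqrt).tendsto 0 |>.comp (h (4 * k))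
  simp only [Function.comp_apply, Real.sqrt_zero] at h1
  refine h1.congr fun n => ?_
  have h2 : 0 ≤ (n : ℝ) ^ k * f n := mul_nonneg (by positivity) (hf n)
  have h3 : (n : ℝ) ^ (4 * k) * f n ^ 4 = (((n : ℝ) ^ k * f n) ^ 2) ^ 2 := by ring
  simp only [Function.comp_apply]
  rw [h3, Real.sqrt_sq (by positivity), Real.sqrt_sq h2]

/-! ### Algebra of the Schnorr scheme -/

namespace GroupGen

variable (𝒢 : GroupGen) (p : 𝒢.Param)

instance orderPrime : Fact (𝒢.order p).Prime := ⟨𝒢.prime_card p⟩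

/-- The generator, written additively. -/
def addGen : Additive (𝒢.G p) := Additive.ofMul (𝒢.gen p)

theorem val_nsmul (r : ZMod (𝒢.order p)) (x : Additive (𝒢.G p)) : r.val • x = r • x := by
  rw [← Nat.cast_smul_eq_nsmul (ZMod (𝒢.order p)), ZMod.natCast_zmod_val]

theorem ofMul_gen_pow (r : ZMod (𝒢.order p)) :
    Additive.ofMul (𝒢.gen p ^ r.val) = r • 𝒢.addGen p := by
  rw [ofMul_pow, val_nsmul]
  rfl

theorem exists_smul_addGen (x : Additive (𝒢.G p)) : ∃ r : ZMod (𝒢.order p), x = r • 𝒢.addGen p := by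
  obtain ⟨k, hk⟩ := Subgroup.mem_zpowers_iff.1 (𝒢.gen_generates p x.toMul)
  refine ⟨k, ?_⟩
  rw [Int.cast_smul_eq_zsmul]
  exact (congrArg Additive.ofMul hk).symm

/-- The map is onto because `g` generates, and both sides have `q` elements. -/
theorem smul_addGen_injective :
    Function.Injective fun r : ZMod (𝒢.order p) => r • 𝒢.addGen p := by
  have hfin : Finite (𝒢.G p) := Nat.finite_of_card_ne_zero (𝒢.prime_card p).ne_zero
  have hsurj : Function.Surjective fun r : ZMod (𝒢.order p) => r • 𝒢.addGen p := fun x => by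
    obtain ⟨r, hr⟩ := 𝒢.exists_smul_addGen p x
    exact ⟨r, hr.symm⟩
  refine (hsurj.bijective_of_nat_card_le ?_).1
  rw [Nat.card_zmod]
  rfl

theorem verify_schnorr (τ : ℕ) (A X : Additive (𝒢.G p)) (c z : ZMod (𝒢.order p)) :
    𝒢.schnorr.verify p τ A X c z = true ↔ z • 𝒢.addGen p = c • A + X := by
  simp only [schnorr, decide_eq_true_eq]
  rw [← ofMul_gen_pow, ← val_nsmul]
  exact Iff.rfl

theorem mem_support_keygen {k : Additive (𝒢.G p) × ZMod (𝒢.order p)} :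
    k ∈ (𝒢.schnorr.keygen p).support ↔ k.1 = k.2 • 𝒢.addGen p := by
  refine (PMF.mem_support_map_iff _ _ _).trans ⟨?_, fun h => ⟨k.2, ?_, ?_⟩⟩
  · rintro ⟨s, -, rfl⟩
    exact 𝒢.ofMul_gen_pow p s
  · exact PMF.mem_support_uniformOfFintype _
  · exact Prod.ext ((𝒢.ofMul_gen_pow p _).trans h.symm) rfl

theorem mem_support_commit {m : ZMod (𝒢.order p) × Additive (𝒢.G p)} :
    m ∈ (𝒢.schnorr.commit p).support ↔ m.2 = m.1 • 𝒢.addGen p := by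
  refine (PMF.mem_support_map_iff _ _ _).trans ⟨?_, fun h => ⟨m.1, ?_, ?_⟩⟩
  · rintro ⟨s, -, rfl⟩
    exact 𝒢.ofMul_gen_pow p s
  · exact PMF.mem_support_uniformOfFintype _
  · exact Prod.ext rfl ((𝒢.ofMul_gen_pow p _).trans h.symm)

variable {𝒢 p} in
theorem sum_smul_eq {t : ℕ} {w s : Fin t → ZMod (𝒢.order p)} {A : Fin t → Additive (𝒢.G p)}
    (h : ∀ i, A i = s i • 𝒢.addGen p) : ∑ i, w i • A i = (∑ i, w i • s i) • 𝒢.addGen p := by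
  rw [Finset.sum_smul]
  exact Finset.sum_congr rfl fun i _ => by rw [h i, smul_assoc]

theorem respond_smul (s x c : ZMod (𝒢.order p)) :
    (s * c + x) • 𝒢.addGen p = c • s • 𝒢.addGen p + x • 𝒢.addGen p := by
  rw [add_smul, mul_comm, mul_smul]

variable {𝒢 p} in
theorem sum_respond_smul {t : ℕ} {w s x z : Fin t → ZMod (𝒢.order p)} {c : ZMod (𝒢.order p)}
    {A X : Fin t → Additive (𝒢.G p)} (hA : ∀ i, A i = s i • 𝒢.addGen p)
    (hX : ∀ i, X i = x i • 𝒢.addGen p) (hz : ∀ i, z i = s i * c + x i) :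
    (∑ i, w i • z i) • 𝒢.addGen p = c • ∑ i, w i • A i + ∑ i, w i • X i := by
  rw [← sum_smul_eq fun i => rfl, Finset.smul_sum, ← Finset.sum_add_distrib]
  refine Finset.sum_congr rfl fun i _ => ?_
  rw [hz i, hA i, hX i, respond_smul, smul_add, smul_comm (w i) c]

theorem schnorr_isLinear : 𝒢.schnorr.IsLinear where
  keys p _ _ _ _ _ hk :=
    (𝒢.mem_support_keygen p).2 (sum_smul_eq fun i => (𝒢.mem_support_keygen p).1 (hk i))
  transcripts p _ _ _ _ _ _ _ _ hk hm _ hz :=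
    (𝒢.verify_schnorr p _ _ _ _ _).2 <| sum_respond_smul
      (fun i => (𝒢.mem_support_keygen p).1 (hk i)) (fun i => (𝒢.mem_support_commit p).1 (hm i))
      fun i => (PMF.mem_support_pure_iff _ _).1 (hz i)

theorem schnorr_correct : 𝒢.schnorr.Correct := by
  intro τ _
  have h : ∀ n, 𝒢.schnorr.honest τ n false = 0 := by
    intro n
    rw [PMF.apply_eq_zero_iff]
    intro h
    obtain ⟨p, -, h⟩ := (PMF.mem_support_bind_iff _ _ _).1 h
    obtain ⟨k, hk, h⟩ := (PMF.mem_support_bind_iff _ _ _).1 h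
    obtain ⟨m, hm, h⟩ := (PMF.mem_support_bind_iff _ _ _).1 h
    obtain ⟨c, -, h⟩ := (PMF.mem_support_bind_iff _ _ _).1 h
    obtain ⟨z, hz, h⟩ := (PMF.mem_support_bind_iff _ _ _).1 h
    have hv : 𝒢.schnorr.verify p τ k.1 m.2 c z = true := by
      refine (𝒢.verify_schnorr p _ _ _ _ _).2 ?_
      rw [(PMF.mem_support_pure_iff _ _).1 hz, (𝒢.mem_support_keygen p).1 hk,
        (𝒢.mem_support_commit p).1 hm]
      exact 𝒢.respond_smul p _ _ _
    rw [hv, PMF.mem_support_pure_iff] at h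
    exact Bool.false_ne_true h
  simp only [h, ENNReal.toReal_zero]
  exact negligible_zero

/-- The expected inverse of the group order. -/
def invOrder (n : ℕ) : ℝ≥0∞ := (𝒢.setup n).expect fun p => (𝒢.order p : ℝ≥0∞)⁻¹

variable {𝒢} in
-- The solver that always answers `0` succeeds exactly when `x = 0`, that is, with probability
-- `1/q`.
theorem DiscreteLogAssumption.negligible_invOrder (h : 𝒢.DiscreteLogAssumption) :
    Negligible fun n => (𝒢.invOrder n).toReal := by
  classical
  obtain ⟨A, hA⟩ := PolyTime.exists_ppt (PolyFun.const (.num 0))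
  refine (h A).congr fun n => ?_
  congr 1
  rw [dlogExperiment, PMF.bind_apply_eq_expect, invOrder]
  congr 1
  funext p
  rw [hA]
  simp only [PMF.pure_bind]
  rw [← Function.comp_def (f := PMF.pure), PMF.bind_pure_comp, PMF.map_uniformOfFintype_apply,
    ZMod.card]
  have : (Finset.univ.filter fun x : ZMod (𝒢.order p) =>
      decide (Data.num 0 = .num x.val) = true) = {0} := by
    ext x
    simp [eq_comm (a := 0), ZMod.val_eq_zero]
  rw [this, Finset.card_singleton, Nat.cast_one, one_mul]

theorem map_ofMul_gen_pow_le (X : Additive (𝒢.G p)) :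
    (PMF.uniformOfFintype (ZMod (𝒢.order p))).map (fun x => Additive.ofMul (𝒢.gen p ^ x.val)) X ≤
      (𝒢.order p : ℝ≥0∞)⁻¹ := by
  classical
  rw [PMF.map_uniformOfFintype_apply, ZMod.card]
  refine mul_le_of_le_one_left zero_le ?_
  refine Nat.cast_le_one.2 (Finset.card_le_one.2 fun a ha b hb => ?_)
  simp only [Finset.mem_filter, Finset.mem_univ, true_and] at ha hb
  apply 𝒢.smul_addGen_injective p
  simp only [← ofMul_gen_pow]
  exact ha.trans hb.symm

theorem expect_iSup_commit (n : ℕ) :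
    (∑' p, 𝒢.schnorr.setup n p * ⨆ X, ((𝒢.schnorr.commit p).map Prod.snd) X) ≤ 𝒢.invOrder n := by
  refine PMF.expect_mono _ fun (p : 𝒢.Param) => iSup_le fun X => ?_
  exact (DFunLike.congr_fun (PMF.map_comp _ _ _) X).trans_le (𝒢.map_ofMul_gen_pow_le p X)

theorem invOrder_ne_top (n : ℕ) : 𝒢.invOrder n ≠ ⊤ := by
  refine ne_top_of_le_ne_top ENNReal.one_ne_top (PMF.expect_le_one _ fun p => ?_)
  exact ENNReal.inv_le_one.2 (Nat.one_le_cast.2 (𝒢.prime_card p).one_le)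

variable {𝒢} in
theorem DiscreteLogAssumption.commitmentEntropy (h : 𝒢.DiscreteLogAssumption) :
    𝒢.schnorr.CommitmentEntropy :=
  h.negligible_invOrder.mono (fun _ => ENNReal.toReal_nonneg) fun n =>
    ENNReal.toReal_mono (𝒢.invOrder_ne_top n) (𝒢.expect_iSup_commit n)

end GroupGen

/-! ### The reduction -/

/-- A number congruent to `a - b` modulo `q`. -/
def subMod (q a b : ℕ) : ℕ := a + b * (q - 1)

@[fun_prop]
theorem PolyNat.subMod {q a b : Data → ℕ} (hq : PolyNat q) (ha : PolyNat a) (hb : PolyNat b) :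
    PolyNat fun x => subMod (q x) (a x) (b x) := by
  unfold _root_.subMod
  fun_prop

theorem cast_subMod (q a b : ℕ) [NeZero q] : (subMod q a b : ZMod q) = a - b := by
  rw [subMod, Nat.cast_add, Nat.cast_mul, Nat.cast_sub (NeZero.one_le)]
  simp
  ring

/-- The secret key computed from two weights `w`, `w'` and, for each of them, two accepted
transcripts `(c₁, z₁)`, `(c₂, z₂)` with the same commitment. -/
def extractKey (q w : ℕ) (b : Data) (w' : ℕ) (b' : Data) : ℕ :=
  subMod q
      (subMod q b.fst.snd.toNat b.snd.snd.toNat * subMod q b'.fst.fst.toNat b'.snd.fst.toNat)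
      (subMod q b'.fst.snd.toNat b'.snd.snd.toNat * subMod q b.fst.fst.toNat b.snd.fst.toNat) *
    powMod (subMod q b.fst.fst.toNat b.snd.fst.toNat *
      subMod q b'.fst.fst.toNat b'.snd.fst.toNat * subMod q w w') (q - 2) q % atLeastOne q

@[fun_prop]
theorem PolyNat.extractKey {q w w' : Data → ℕ} {b b' : Data → Data} (hq : PolyNat q)
    (hw : PolyNat w) (hb : PolyFun b) (hw' : PolyNat w') (hb' : PolyFun b') :
    PolyNat fun x => extractKey (q x) (w x) (b x) (w' x) (b' x) := by
  unfold _root_.extractKey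
  fun_prop

/-- Two transcripts with the same commitment. -/
def transcriptPair {q : ℕ} (c₁ c₂ z₁ z₂ : ZMod q) : Data :=
  .pair (.pair (.num c₁.val) (.num z₁.val)) (.pair (.num c₂.val) (.num z₂.val))

/-- Here `a` and `a'` are the logarithms of the two aggregated keys and `s = (a - a') / (w - w')`.
Over the common denominator `(c₁ - c₂) * (c₁' - c₂') * (w - w')` a single inversion remains, done by
Fermat as a power with exponent `q - 2`. -/
theorem extractKey_eq {q : ℕ} [hq : Fact q.Prime] {w w' c₁ c₂ z₁ z₂ c₁' c₂' z₁' z₂' a a' s : ZMod q}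
    (hc : c₁ ≠ c₂) (hc' : c₁' ≠ c₂') (hw : w ≠ w') (ha : z₁ - z₂ = (c₁ - c₂) * a)
    (ha' : z₁' - z₂' = (c₁' - c₂') * a') (hs : a - a' = (w - w') * s) :
    extractKey q w.val (transcriptPair c₁ c₂ z₁ z₂) w'.val (transcriptPair c₁' c₂' z₁' z₂') =
      s.val := by
  have hq0 : q ≠ 0 := hq.out.ne_zero
  have hlt : extractKey q w.val (transcriptPair c₁ c₂ z₁ z₂) w'.val
      (transcriptPair c₁' c₂' z₁' z₂') < q := by
    rw [extractKey, atLeastOne_of_ne_zero hq0]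
    exact Nat.mod_lt _ hq.out.pos
  rw [← ZMod.val_cast_of_lt hlt]
  congr 1
  have hd : (c₁ - c₂) * (c₁' - c₂') * (w - w') ≠ 0 :=
    mul_ne_zero (mul_ne_zero (sub_ne_zero.2 hc) (sub_ne_zero.2 hc')) (sub_ne_zero.2 hw)
  have hpow : ((c₁ - c₂) * (c₁' - c₂') * (w - w')) * ((c₁ - c₂) * (c₁' - c₂') * (w - w')) ^ (q - 2)
      = 1 := by
    rw [← pow_succ', ← ZMod.pow_card_sub_one_eq_one hd]
    congr 1
    have := hq.out.two_le
    lia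
  rw [extractKey, atLeastOne_of_ne_zero hq0, ZMod.natCast_mod, Nat.cast_mul, powMod_cast _ _ _ hq0]
  simp only [transcriptPair, cast_subMod, Nat.cast_mul, Data.fst_pair, Data.snd_pair,
    Data.toNat_num, ZMod.natCast_zmod_val]
  rw [ha, ha']
  calc _ = (c₁ - c₂) * (c₁' - c₂') * (a - a') *
        ((c₁ - c₂) * (c₁' - c₂') * (w - w')) ^ (q - 2) := by ring
    _ = s * (((c₁ - c₂) * (c₁' - c₂') * (w - w')) *
        ((c₁ - c₂) * (c₁' - c₂') * (w - w')) ^ (q - 2)) := by rw [hs]; ring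
    _ = s := by rw [hpow, mul_one]

namespace Impersonator

variable (A : Impersonator)

/-- Run the last two phases with two challenges for the same commitment. -/
def fork (sample : PMF Data) (x : Data) : PMF Data :=
  (A.commit.out x).bind fun y =>
  sample.bind fun c₁ =>
  sample.bind fun c₂ =>
  (A.respond.out (.pair y.fst c₁)).bind fun z₁ =>
  (A.respond.out (.pair y.fst c₂)).bind fun z₂ =>
  PMF.pure (.pair (.pair c₁ z₁) (.pair c₂ z₂))

/-- Fork twice, with two values of the first weight, and extract a secret key. -/
def solve (q : ℕ) (sample sampleL : PMF Data) (st : Data) : PMF Data :=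
  sampleL.bind fun v =>
  sample.bind fun w =>
  sample.bind fun w' =>
  (A.fork sample (.pair st (.pair w v))).bind fun b =>
  (A.fork sample (.pair st (.pair w' v))).bind fun b' =>
  PMF.pure (.num (extractKey q w.toNat b w'.toNat b'))

theorem fork_dominates {θ : ℝ≥0∞} {μ ν : PMF Data} (h : PMF.Dominates θ μ ν) (x : Data) :
    PMF.Dominates (θ ^ 2) (A.fork μ x) (A.fork ν x) := by
  rw [← mul_one (θ ^ 2), sq, mul_assoc]
  exact .bind_right _ fun y => h.bind fun c₁ => h.bind fun c₂ => .refl _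

/-- The exponent `6` counts the residues drawn besides the list: two honest weights and two
challenges in each of two forks. -/
theorem solve_dominates {θ θ' : ℝ≥0∞} {μ ν μ' ν' : PMF Data} (h : PMF.Dominates θ μ ν)
    (h' : PMF.Dominates θ' μ' ν') (q : ℕ) (st : Data) :
    PMF.Dominates (θ' * θ ^ 6) (A.solve q μ μ' st) (A.solve q ν ν' st) := by
  have e : θ' * θ ^ 6 = θ' * (θ * (θ * (θ ^ 2 * (θ ^ 2 * 1)))) := by ring
  rw [e]
  exact h'.bind fun v => h.bind fun w => h.bind fun w' =>
    (A.fork_dominates h _).bind fun b => (A.fork_dominates h _).bind fun b' => .refl _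

/-- The number of coins, as the length of a list, that suffices to sample a residue modulo `q` in
an attack in which the adversary outputs the list `l` of keys. -/
def coinList (q : ℕ) (l : Data) : Data :=
  (binaryDigits q (.num 0)).revAppend (l.revAppend (.ofList (List.replicate 6 (.num 0))))

/-- The digits of `q` account for the factor `q`; the key list and the six padding entries provide
one spare bit for every residue the solver draws. -/
theorem le_two_pow_length_coinList (q : ℕ) (l : Data) :
    q * 2 ^ (l.toList.length + 6) ≤ 2 ^ (coinList q l).toList.length := by
  have h := le_two_pow_length_binaryDigits q (.num 0)
  simp only [Data.toList, List.length_nil, pow_zero, mul_one] at h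
  have h6 : (Data.ofList (List.replicate 6 (.num 0))).toList.length = 6 := rfl
  rw [coinList, Data.length_revAppend, Data.length_revAppend, h6, pow_add 2 _ (l.toList.length + 6)]
  exact Nat.mul_le_mul_right _ (Nat.le_of_succ_le h)

/-- The solver for discrete logarithms. -/
def dlogSolver (x : Data) : PMF Data :=
  (A.keys.out x).bind fun y =>
  A.solve x.snd.fst.fst.toNat
    (sampleMod (coinList x.snd.fst.fst.toNat y.snd) (.num x.snd.fst.fst.toNat))
    (sampleModList (coinList x.snd.fst.fst.toNat y.snd) (.num x.snd.fst.fst.toNat) y.snd) y.fst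

end Impersonator

@[fun_prop]
theorem PolyFun.coinList {q l : Data → Data} (hq : PolyFun q) (hl : PolyFun l) :
    PolyFun fun x => Impersonator.coinList (q x).toNat (l x) := by
  unfold Impersonator.coinList
  fun_prop

theorem PolyTime.fork (A : Impersonator) {k q f : Data → Data} (hk : PolyFun k) (hq : PolyFun q)
    (hf : PolyFun f) : PolyTime fun x => A.fork (_root_.sampleMod (k x) (q x)) (f x) := by
  unfold Impersonator.fork
  refine .bind (A.commit.polyTime.of_fun hf) ?_
  refine .bind (.sampleMod (by fun_prop) (by fun_prop)) ?_
  refine .bind (.sampleMod (by fun_prop) (by fun_prop)) ?_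
  -- The environment is now `(((x, y), c₁), c₂)`; in the next run of the response phase it has `z₁`
  -- appended.
  refine .bind (A.respond.polyTime.of_fun (f := fun d => .pair d.fst.fst.snd.fst d.fst.snd)
    (by fun_prop)) ?_
  refine .bind (A.respond.polyTime.of_fun (f := fun d => .pair d.fst.fst.fst.snd.fst d.fst.snd)
    (by fun_prop)) ?_
  exact (show PolyFun _ by fun_prop)

theorem Impersonator.polyTime_dlogSolver (A : Impersonator) : PolyTime A.dlogSolver := by
  unfold Impersonator.dlogSolver Impersonator.solve
  refine .bind A.keys.polyTime ?_
  refine .bind (.sampleModList (by fun_prop) (by fun_prop) (by fun_prop)) ?_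
  refine .bind (.sampleMod (by fun_prop) (by fun_prop)) ?_
  refine .bind (.sampleMod (by fun_prop) (by fun_prop)) ?_
  refine .bind (.fork A (by fun_prop) (by fun_prop) (by fun_prop)) ?_
  refine .bind (.fork A (by fun_prop) (by fun_prop) (by fun_prop)) ?_
  exact (show PolyFun _ by fun_prop)

/-! ### Security -/

theorem indicator_le_one (P : Prop) [Decidable P] : (if P then 1 else 0 : ℝ≥0∞) ≤ 1 := by
  split_ifs <;> simp

theorem expect_uniformMod (q : ℕ) [NeZero q] (f : Data → ℝ≥0∞) :
    (uniformMod q).expect f =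
      (PMF.uniformOfFintype (ZMod q)).expect fun r => f (.num r.val) :=
  PMF.expect_map _ _ _

namespace GroupGen

variable (𝒢 : GroupGen) (A : Impersonator) (p : 𝒢.Param)

/-- The adversary's commitment and response are well formed and accepted for the key `B`. -/
def Accepts (B : Additive (𝒢.G p)) (y : Data) (c : ZMod (𝒢.order p)) (z : Data) : Prop :=
  ∃ (X : Additive (𝒢.G p)) (r : ZMod (𝒢.order p)), 𝒢.enc p X.toMul = y.snd ∧ .num r.val = z ∧
    r • 𝒢.addGen p = c • B + X

open Classical in
/-- The probability that the last two phases of `A` on input `x` are accepted for the key `B`. -/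
def acceptProb (B : Additive (𝒢.G p)) (x : Data) : ℝ≥0∞ :=
  (A.commit.out x).expect fun y =>
  (PMF.uniformOfFintype (ZMod (𝒢.order p))).expect fun c =>
  (A.respond.out (.pair y.fst (.num c.val))).expect fun z =>
  if 𝒢.Accepts p B y c z then 1 else 0

/-- Two transcripts with distinct challenges that determine the discrete logarithm of `B`. -/
def GoodPair (B : Additive (𝒢.G p)) (b : Data) : Prop :=
  ∃ c₁ c₂ z₁ z₂ : ZMod (𝒢.order p), b = transcriptPair c₁ c₂ z₁ z₂ ∧ c₁ ≠ c₂ ∧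
    (z₁ - z₂) • 𝒢.addGen p = (c₁ - c₂) • B

open Classical in
/-- The probability that forking yields a `GoodPair`. -/
def forkProb (B : Additive (𝒢.G p)) (x : Data) : ℝ≥0∞ :=
  (A.fork (uniformMod (𝒢.order p)) x).expect fun b => if 𝒢.GoodPair p B b then 1 else 0

variable {𝒢 p} in
-- Special soundness: equal encodings force equal commitments, which cancel when the two
-- verification equations are subtracted.
theorem Accepts.goodPair {B : Additive (𝒢.G p)} {y z₁ z₂ : Data} {c₁ c₂ : ZMod (𝒢.order p)}
    (h₁ : 𝒢.Accepts p B y c₁ z₁) (h₂ : 𝒢.Accepts p B y c₂ z₂) (hc : c₁ ≠ c₂) :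
    𝒢.GoodPair p B (.pair (.pair (.num c₁.val) z₁) (.pair (.num c₂.val) z₂)) := by
  obtain ⟨X, r₁, hX, rfl, e₁⟩ := h₁
  obtain ⟨X', r₂, hX', rfl, e₂⟩ := h₂
  obtain rfl : X = X' := 𝒢.enc_injective p (hX.trans hX'.symm)
  refine ⟨c₁, c₂, r₁, r₂, rfl, hc, ?_⟩
  rw [sub_smul, sub_smul, e₁, e₂, add_sub_add_right_eq_sub]

open Classical in
theorem forkProb_le_one (B : Additive (𝒢.G p)) (x : Data) : 𝒢.forkProb A p B x ≤ 1 :=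
  PMF.expect_le_one _ fun _ => indicator_le_one _

/-- Forking over the challenge: Jensen averages over the commitment phase, after which the two
responses are independent runs from the same state. -/
theorem sq_acceptProb_le (B : Additive (𝒢.G p)) (x : Data) :
    𝒢.acceptProb A p B x ^ 2 ≤ 𝒢.forkProb A p B x + (𝒢.order p : ℝ≥0∞)⁻¹ := by
  classical
  refine (PMF.sq_expect_le _ _).trans ?_
  rw [forkProb, Impersonator.fork, PMF.expect_bind, ← PMF.expect_const (A.commit.out x)
    (𝒢.order p : ℝ≥0∞)⁻¹, ← PMF.expect_add]
  refine PMF.expect_mono _ fun y => ?_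
  refine (PMF.sq_expect_uniform_le fun c => PMF.expect_le_one _ fun z => indicator_le_one _).trans ?_
  rw [ZMod.card]
  gcongr
  rw [PMF.expect_bind, expect_uniformMod]
  refine PMF.expect_mono _ fun c₁ => ?_
  rw [PMF.expect_bind, expect_uniformMod]
  refine PMF.expect_mono _ fun c₂ => ?_
  split_ifs with hc
  · exact zero_le
  · simp only [PMF.expect_mul_expect, PMF.expect_bind, PMF.expect_pure]
    refine PMF.expect_mono _ fun z₁ => PMF.expect_mono _ fun z₂ => ?_
    by_cases h₁ : 𝒢.Accepts p B y c₁ z₁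
    · by_cases h₂ : 𝒢.Accepts p B y c₂ z₂
      · rw [if_pos (h₁.goodPair h₂ hc)]
        exact mul_le_one' (indicator_le_one _) (indicator_le_one _)
      · rw [if_neg h₂, mul_zero]
        exact zero_le
    · rw [if_neg h₁, zero_mul]
      exact zero_le

variable {𝒢 p} in
-- With `B = r • g` the two keys have logarithms `w * s + r` and `w' * s + r`. Their difference does
-- not involve `r`, which the solver does not know.
theorem GoodPair.extractKey_eq {B : Additive (𝒢.G p)} {s w w' : ZMod (𝒢.order p)} {b b' : Data}
    (h : 𝒢.GoodPair p (w • s • 𝒢.addGen p + B) b)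
    (h' : 𝒢.GoodPair p (w' • s • 𝒢.addGen p + B) b') (hw : w ≠ w') :
    extractKey (𝒢.order p) w.val b w'.val b' = s.val := by
  obtain ⟨c₁, c₂, z₁, z₂, rfl, hc, e⟩ := h
  obtain ⟨c₁', c₂', z₁', z₂', rfl, hc', e'⟩ := h'
  obtain ⟨r, rfl⟩ := 𝒢.exists_smul_addGen p B
  simp only [smul_smul, ← add_smul] at e e'
  exact _root_.extractKey_eq hc hc' hw (𝒢.smul_addGen_injective p e)
    (𝒢.smul_addGen_injective p e') (by ring)

/-- A list of uniform weights, as a datum. -/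
def weightList (q k : ℕ) [NeZero q] : PMF Data :=
  (sampleList (PMF.uniformOfFintype (ZMod q)) k).map fun w => .ofList (w.map fun r => .num r.val)

/-- With the adversary's weights fixed, the outer fork resamples the honest weight and the inner
forks resample the challenge. Squaring twice gives the fourth power and collects the collision terms
into `4/q`. -/
theorem pow_four_acceptProb_le (s : ZMod (𝒢.order p)) (pks : List (Additive (𝒢.G p)))
    (st : Data) :
    ((sampleList (PMF.uniformOfFintype (ZMod (𝒢.order p))) (pks.length + 1)).expect fun w =>
      𝒢.acceptProb A p (List.zipWith (fun a b => a • b) w (s • 𝒢.addGen p :: pks)).sum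
        (.pair st (.ofList (w.map fun r => .num r.val)))) ^ 4 ≤
    2 * A.solve (𝒢.order p) (uniformMod (𝒢.order p)) (weightList (𝒢.order p) pks.length) st
      (.num s.val) + 4 * (𝒢.order p : ℝ≥0∞)⁻¹ := by
  classical
  set U := PMF.uniformOfFintype (ZMod (𝒢.order p))
  set ε : ℝ≥0∞ := (𝒢.order p : ℝ≥0∞)⁻¹
  have hε1 : ε ≤ 1 := ENNReal.inv_le_one.2 (Nat.one_le_cast.2 (𝒢.prime_card p).one_le)
  simp only [sampleList, PMF.expect_bind, PMF.expect_pure]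
  -- The honest weight is drawn first; exchanging the order makes it the inner variable, so that it
  -- can be resampled with the other weights `v` held fixed.
  rw [PMF.expect_comm]
  refine (PMF.expect_pow_four_le _ _).trans ?_
  rw [Impersonator.solve, PMF.bind_apply_eq_expect, weightList, PMF.expect_map,
    ← PMF.expect_const_mul, ← PMF.expect_const (sampleList U pks.length) (4 * ε), ← PMF.expect_add]
  refine PMF.expect_mono _ fun v => ?_
  set B := (List.zipWith (fun a b => a • b) v pks).sum
  set x : ZMod (𝒢.order p) → Data := fun w =>
    .pair st (.pair (.num w.val) (.ofList (v.map fun r => .num r.val)))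
  change (U.expect fun w => 𝒢.acceptProb A p (w • s • 𝒢.addGen p + B) (x w)) ^ 4 ≤ _
  set G : ℝ≥0∞ := U.expect fun w => 𝒢.forkProb A p (w • s • 𝒢.addGen p + B) (x w)
  have h1 : (U.expect fun w => 𝒢.acceptProb A p (w • s • 𝒢.addGen p + B) (x w)) ^ 2 ≤ G + ε := by
    refine (PMF.sq_expect_le _ _).trans ?_
    rw [← PMF.expect_const U ε, ← PMF.expect_add]
    exact PMF.expect_mono _ fun w => 𝒢.sq_acceptProb_le A p _ _
  -- The outer fork: for `w ≠ w'`, two good pairs make the extraction return `s`; the case `w = w'`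
  -- is the added collision term.
  have h2 : G ^ 2 ≤ ((uniformMod (𝒢.order p)).bind fun w =>
      (uniformMod (𝒢.order p)).bind fun w' =>
      (A.fork (uniformMod (𝒢.order p))
        (.pair st (.pair w (.ofList (v.map fun r => .num r.val))))).bind fun b =>
      (A.fork (uniformMod (𝒢.order p))
        (.pair st (.pair w' (.ofList (v.map fun r => .num r.val))))).bind fun b' =>
      PMF.pure (Data.num (extractKey (𝒢.order p) w.toNat b w'.toNat b'))) (Data.num s.val) + ε := by
    refine (PMF.sq_expect_uniform_le fun w => 𝒢.forkProb_le_one A p _ _).trans ?_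
    rw [ZMod.card]
    gcongr
    rw [PMF.bind_apply_eq_expect]
    refine le_of_le_of_eq ?_ (expect_uniformMod _ _).symm
    refine PMF.expect_mono _ fun w => ?_
    rw [PMF.bind_apply_eq_expect]
    refine le_of_le_of_eq ?_ (expect_uniformMod _ _).symm
    refine PMF.expect_mono _ fun w' => ?_
    split_ifs with hw
    · exact zero_le
    · rw [forkProb, forkProb, PMF.expect_mul_expect, PMF.bind_apply_eq_expect]
      refine PMF.expect_mono _ fun b => ?_
      rw [PMF.bind_apply_eq_expect]
      refine PMF.expect_mono _ fun b' => ?_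
      rw [Data.toNat_num, Data.toNat_num]
      by_cases hb : 𝒢.GoodPair p (w • s • 𝒢.addGen p + B) b
      · by_cases hb' : 𝒢.GoodPair p (w' • s • 𝒢.addGen p + B) b'
        · rw [hb.extractKey_eq hb' hw, PMF.pure_apply_self]
          exact mul_le_one' (indicator_le_one _) (indicator_le_one _)
        · rw [if_neg hb', mul_zero]
          exact zero_le
      · rw [if_neg hb, zero_mul]
        exact zero_le
  calc (U.expect fun w => 𝒢.acceptProb A p (w • s • 𝒢.addGen p + B) (x w)) ^ 4
      = ((U.expect fun w => 𝒢.acceptProb A p (w • s • 𝒢.addGen p + B) (x w)) ^ 2) ^ 2 := by ring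
    _ ≤ (G + ε) ^ 2 := by gcongr
    _ ≤ 2 * G ^ 2 + 2 * ε ^ 2 := ENNReal.add_sq_le _ _
    _ ≤ 2 * (_ + ε) + 2 * ε := by
        gcongr
        exact pow_le_of_le_one zero_le hε1 two_ne_zero
    _ = _ := by ring

/-- The input of a solver for the discrete logarithm `s`. -/
def dlogInput (n : ℕ) (s : ZMod (𝒢.order p)) : Data :=
  .pair (.unary n) (.pair (𝒢.pub p) (𝒢.enc p (𝒢.gen p ^ s.val)))

theorem dlogExperiment_true (D : PPT) (n : ℕ) : 𝒢.dlogExperiment D n true =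
    (𝒢.setup n).expect fun p => (PMF.uniformOfFintype (ZMod (𝒢.order p))).expect fun s =>
      D.out (𝒢.dlogInput p n s) (.num s.val) := by
  classical
  rw [dlogExperiment, PMF.bind_apply_eq_expect]
  congr 1; funext p
  rw [PMF.bind_apply_eq_expect]
  congr 1; funext s
  rw [PMF.bind_apply]
  refine (tsum_eq_single (.num s.val) fun y hy => ?_).trans ?_
  · simp [hy]
  · simp [dlogInput]

/-- The list of keys encoded by the list `l`. -/
def decodeKeys (l : Data) : Option (List (Additive (𝒢.G p))) :=
  l.toList.mapM (Function.partialInv fun X : Additive (𝒢.G p) => 𝒢.enc p X.toMul)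

theorem length_of_mapM_eq_some {α β : Type*} {f : α → Option β} {l : List α} {m : List β}
    (h : l.mapM f = some m) : m.length = l.length := by
  induction l generalizing m with
  | nil => simp_all
  | cons a l ih =>
    simp only [List.mapM_cons, Option.bind_eq_bind, Option.bind_eq_some_iff, Option.pure_def,
      Option.some.injEq] at h
    obtain ⟨b, -, m, hm, rfl⟩ := h
    simp [ih hm]

/-- Ill-formed outputs contribute nothing to the experiment, and decoding succeeds only on genuine
encodings, so every win is counted by `Accepts`. -/
theorem experiment_true_le (n : ℕ) : 𝒢.schnorr.experiment A n true ≤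
    (𝒢.setup n).expect fun p => (PMF.uniformOfFintype (ZMod (𝒢.order p))).expect fun s =>
      (A.keys.out (𝒢.dlogInput p n s)).expect fun y =>
        (𝒢.decodeKeys p y.snd).elim 0 fun pks =>
          (sampleList (PMF.uniformOfFintype (ZMod (𝒢.order p))) (pks.length + 1)).expect fun w =>
            𝒢.acceptProb A p (List.zipWith (fun a b => a • b) w (s • 𝒢.addGen p :: pks)).sum
              (.pair y.fst (.ofList (w.map fun r => .num r.val))) := by
  classical
  rw [IDScheme.experiment, PMF.bind_apply_eq_expect]
  refine PMF.expect_mono _ fun (p : 𝒢.Param) => ?_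
  rw [PMF.bind_apply_eq_expect]
  refine (PMF.expect_map (PMF.uniformOfFintype (ZMod (𝒢.order p)))
    (fun s => (Additive.ofMul (𝒢.gen p ^ s.val), s)) _).trans_le ?_
  refine PMF.expect_mono _ fun s => ?_
  rw [PMF.bind_apply_eq_expect]
  refine PMF.expect_mono _ fun y => ?_
  have hd : 𝒢.decodeKeys p y.snd =
      y.snd.toList.mapM (Function.partialInv (𝒢.schnorr.encPK p)) := rfl
  rw [hd]
  rcases y.snd.toList.mapM (Function.partialInv (𝒢.schnorr.encPK p)) with _ | pks
  · simp
  · simp only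
    rw [PMF.bind_apply_eq_expect]
    refine PMF.expect_mono _ fun w => ?_
    rw [PMF.bind_apply_eq_expect]
    refine PMF.expect_mono _ fun y₂ => ?_
    rw [PMF.bind_apply_eq_expect]
    refine PMF.expect_mono _ fun c => ?_
    rw [PMF.bind_apply_eq_expect]
    refine PMF.expect_mono _ fun y₃ => ?_
    rcases hX : Function.partialInv (𝒢.schnorr.encCMT p) y₂.snd with _ | X
    · simp
    rcases hz : Function.partialInv (𝒢.schnorr.encRSP p) y₃ with _ | z
    · simp
    rw [← 𝒢.ofMul_gen_pow]
    split_ifs with hv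
    · exact PMF.coe_le_one _ _
    · refine (PMF.pure_apply_of_ne _ _ fun h => hv ⟨X, z, ?_, ?_, ?_⟩).le
      · exact ((𝒢.schnorr.encCMT_injective p).isPartialInv _ _).1 hX
      · exact ((𝒢.schnorr.encRSP_injective p).isPartialInv _ _).1 hz
      · exact (𝒢.verify_schnorr p _ _ _ _ _).1 h.symm

/-- The solver draws `m = l.toList.length + 6` residues, each at a loss of `1 - 2⁻ᵐ`, and `(1 -
2⁻ᵐ)ᵐ ≥ 1/2`. -/
theorem solve_uniform_le (st l : Data) (d : Data) :
    A.solve (𝒢.order p) (uniformMod (𝒢.order p)) (weightList (𝒢.order p) l.toList.length) st d ≤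
    2 * A.solve (𝒢.order p)
      (sampleMod (Impersonator.coinList (𝒢.order p) l) (.num (𝒢.order p)))
      (sampleModList (Impersonator.coinList (𝒢.order p) l) (.num (𝒢.order p)) l) st d := by
  have h1 := dominates_sampleMod (Impersonator.le_two_pow_length_coinList (𝒢.order p) l)
  have h2 := A.solve_dominates h1 (dominates_sampleModList h1 l) (𝒢.order p) st d
  rw [← pow_add] at h2
  have h3 := (mul_le_mul_left inv_two_le_pow _).trans h2
  rwa [mul_comm, ← div_eq_mul_inv, ENNReal.div_le_iff' two_ne_zero ENNReal.ofNat_ne_top] at h3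

/-- The challenge `g ^ s` plays the honest public key, so solver and experiment share the parameter,
`s` and the first phase. Jensen moves the fourth power inside these three averages; the constant `4`
is `2` from forking times `2` from sampling. -/
theorem pow_four_experiment_le {D : PPT} (hD : D.out = A.dlogSolver) (n : ℕ) :
    𝒢.schnorr.experiment A n true ^ 4 ≤
      4 * 𝒢.dlogExperiment D n true + 4 * 𝒢.invOrder n := by
  rw [dlogExperiment_true, invOrder, ← PMF.expect_const_mul, ← PMF.expect_const_mul,
    ← PMF.expect_add]
  refine (pow_le_pow_left' (𝒢.experiment_true_le A n) 4).trans
    ((PMF.expect_pow_four_le _ _).trans (PMF.expect_mono _ fun p => ?_))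
  set ε : ℝ≥0∞ := (𝒢.order p : ℝ≥0∞)⁻¹
  rw [← PMF.expect_const_mul,
    ← PMF.expect_const (PMF.uniformOfFintype (ZMod (𝒢.order p))) (4 * ε), ← PMF.expect_add]
  refine (PMF.expect_pow_four_le _ _).trans (PMF.expect_mono _ fun s => ?_)
  rw [hD, Impersonator.dlogSolver, PMF.bind_apply_eq_expect, ← PMF.expect_const_mul,
    ← PMF.expect_const (A.keys.out (𝒢.dlogInput p n s)) (4 * ε), ← PMF.expect_add]
  refine (PMF.expect_pow_four_le _ _).trans (PMF.expect_mono _ fun y => ?_)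
  rcases h : 𝒢.decodeKeys p y.snd with _ | pks
  · simp
  · refine (𝒢.pow_four_acceptProb_le A p s pks y.fst).trans ?_
    -- The solver draws one weight per entry of the undecoded list; decoding preserves the length.
    rw [length_of_mapM_eq_some h]
    gcongr ?_ + _
    refine (mul_le_mul_right (𝒢.solve_uniform_le A p y.fst y.snd _) 2).trans ?_
    rw [← mul_assoc]
    norm_num
    exact le_rfl

variable {𝒢} in
theorem DiscreteLogAssumption.negligible_experiment (h : 𝒢.DiscreteLogAssumption) :
    Negligible fun n => (𝒢.schnorr.experiment A n true).toReal := by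
  obtain ⟨D, hD⟩ := A.polyTime_dlogSolver.exists_ppt
  refine .of_pow_four (fun _ => ENNReal.toReal_nonneg) ?_
  have h4 := ((h D).const_mul 4).add (h.negligible_invOrder.const_mul 4)
  refine Negligible.mono h4 (fun _ => by positivity) fun n => ?_
  have h1 := 𝒢.pow_four_experiment_le A hD n
  have hd : 𝒢.dlogExperiment D n true ≠ ⊤ := PMF.apply_ne_top _ _
  have hi := 𝒢.invOrder_ne_top n
  have h2 := ENNReal.toReal_mono (by finiteness) h1
  rw [ENNReal.toReal_pow, ENNReal.toReal_add (by finiteness) (by finiteness), ENNReal.toReal_mul,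
    ENNReal.toReal_mul] at h2
  simpa using h2

end GroupGen

end

theorem mainTheorem4 (𝒢 : GroupGen) (hDL : 𝒢.DiscreteLogAssumption) : 𝒢.schnorr.IsSecure where
  entropy := hDL.commitmentEntropy
  linear := 𝒢.schnorr_isLinear
  correct := 𝒢.schnorr_correct
  security A := hDL.negligible_experiment A
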